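/- **Definitions.** For $r>0$ let $\mathcal B_r$ be the class of Borel sets $B\subset\mathbb R$ with $B\cap(-r,r)=\emptyset$, and let $\mathcal B_0=\bigcup_{r>0}\mathcal B_r$. A *quasi-Lévy type measure* is a function $\nu:\mathcal B_0\to\mathbb R$ whose restriction to $\mathcal B_r$ is a finite signed measure for every $r>0$ and which satisfies $\int_{\mathbb R}(1\wedge x^2)\,|\nu|(dx)<\infty$. Here $\nu^+$, $\nu^-$ and $|\nu|=\nu^++\nu^-$ are the measures on $\mathbb R$ that give mass $0$ to $\{0\}$ and coincide on each $\mathcal B_r$ with the positive part, the negative part and the total variation of $\nu|_{\mathcal B_r}$, and $\int g\,d\nu=\int g\,d\nu^+-\int g\,d\nu^-$. For a finite measure $\mu$ on $\mathbb R$ put $\hat\mu(z)=\int_{\mathbb R}e^{ixz}\,\mu(dx)$. A probability measure $\mu$ on $\mathbb R$ is *quasi-infinitely divisible* if there are $a,\gamma\in\mathbb R$ and a quasi-Lévy type measure $\nu$ such that $$\hat\mu(z)=\exp\Big(-\tfrac12 a z^2+i\gamma z+\int_{\mathbb R}\big(e^{ixz}-1-ixz\mathbf 1_{[-1,1]}(x)\big)\,\nu(dx)\Big)\qquad\text{for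 all }z\in\mathbb R;$$ $(a,\gamma,\nu)$ is then called a characteristic triplet of $\mu$ (it is unique), $a$ the Gaussian variance and $\nu$ the quasi-Lévy measure of $\mu$. **Theorem.** Let $\mu$ be a probability measure on $\mathbb R$ of the form $$\mu(dx)=\mu_d(dx)+f(x)\,\lambda(dx),$$ where $\lambda$ is Lebesgue measure, $f:\mathbb R\to[0,\infty)$ is Borel measurable and Lebesgue integrable, and $\mu_d$ is a non-zero discrete measure supported on a lattice $r+h\mathbb Z$ for some $r\in\mathbb R$ and $h>0$, with $\hat\mu_d(z)\neq0$ for all $z\in\mathbb R$. Then $\mu$ is quasi-infinitely divisible if and only if $\hat\mu(z)\neq0$ for all $z\in\mathbb R$. In that case, every characteristic triplet $(a,\gamma,\nu)$ of $\mu$ satisfies $a=0$ and $\int_{[-1,1]}|x|\,|\nu|(dx)<\infty$; that is, the Gaussian variance of $\mu$ is zero and its quasi-Lévy measure integrates $|x|$ over $[-1,1]$. -/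

import Mathlib

open MeasureTheory Set
open scoped ENNReal

noncomputable section

namespace QuasiInfDiv

/-- The class `𝓑_r` of Borel subsets of `ℝ` that are disjoint from `(-r, r)`. -/
def borelAway (r : ℝ) : Set (Set ℝ) :=
  {B | MeasurableSet B ∧ B ∩ Ioo (-r) r = ∅}

/-- The class `𝓑₀ = ⋃_{r > 0} 𝓑_r` of Borel sets that are bounded away from zero. -/
def borelAwayZero : Set (Set ℝ) :=
  {B | ∃ r : ℝ, 0 < r ∧ B ∈ borelAway r}

/-- A set function `ν : 𝓑₀ → ℝ` whose restriction to every `𝓑_r`, `r > 0`, is a finite signed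
measure. As for `MeasureTheory.VectorMeasure`, the function is defined on all sets and takes the
value `0` outside of its domain `𝓑₀`. -/
structure LocalSignedMeasure where
  /-- The value on a set. -/
  toFun : Set ℝ → ℝ
  /-- The normalisation outside of the domain. -/
  not_mem : ∀ B : Set ℝ, B ∉ borelAwayZero → toFun B = 0
  /-- The empty set has value zero. -/
  empty : toFun ∅ = 0
  /-- The function is countably additive on each `𝓑_r`. -/
  hasSum_iUnion : ∀ r : ℝ, 0 < r → ∀ B : ℕ → Set ℝ, (∀ i, B i ∈ borelAway r) →
    Pairwise (Function.onFun Disjoint B) → HasSum (fun i => toFun (B i)) (toFun (⋃ i, B i))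

namespace LocalSignedMeasure

open scoped Classical in
/-- The restriction of `ν` to `𝓑_r`, regarded as a signed measure on `ℝ` that vanishes on
`(-r, r)`. -/
def restr (ν : LocalSignedMeasure) (r : ℝ) (hr : 0 < r) : SignedMeasure ℝ where
  measureOf' B := if MeasurableSet B then ν.toFun (B \ Ioo (-r) r) else 0
  empty' := by simp [ν.empty]
  not_measurable' B hB := by simp [hB]
  m_iUnion' B hB hd := by
    simp only [hB, MeasurableSet.iUnion hB, if_true, iUnion_sdiff]
    refine ν.hasSum_iUnion r hr _ (fun i => ⟨(hB i).diff measurableSet_Ioo, by simp⟩) ?_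
    exact fun i j hij => (hd hij).mono sdiff_subset sdiff_subset

/-- The annuli `{1 ≤ |x|}` (for `n = 0`) and `{1/(n+1) ≤ |x| < 1/n}` (for `n ≥ 1`), a partition
of `ℝ \ {0}`. -/
def annulus (n : ℕ) : Set ℝ :=
  {x | 1 / ((n : ℝ) + 1) ≤ |x| ∧ (n = 0 ∨ |x| < 1 / (n : ℝ))}

/-- The positive part `ν⁺` of `ν`, glued together from the positive parts of its restrictions. It
is the measure with `ν⁺({0}) = 0` that agrees with `(ν|_{𝓑_r})⁺` on `𝓑_r` for all `r > 0`, see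
`posPart_singleton_zero` and `posPart_apply`. -/
def posPart (ν : LocalSignedMeasure) : Measure ℝ :=
  Measure.sum fun n : ℕ =>
    (ν.restr (1 / ((n : ℝ) + 1)) (by positivity)).toJordanDecomposition.posPart.restrict (annulus n)

/-- The negative part `ν⁻` of `ν`, see `negPart_singleton_zero` and `negPart_apply`. -/
def negPart (ν : LocalSignedMeasure) : Measure ℝ :=
  Measure.sum fun n : ℕ =>
    (ν.restr (1 / ((n : ℝ) + 1)) (by positivity)).toJordanDecomposition.negPart.restrict (annulus n)

/-- The total variation `|ν| = ν⁺ + ν⁻` of `ν`, see `totalVariation_singleton_zero` and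
`totalVariation_apply`. -/
def totalVariation (ν : LocalSignedMeasure) : Measure ℝ :=
  ν.posPart + ν.negPart

/-- The integral `∫ g dν = ∫ g dν⁺ - ∫ g dν⁻`, for functions `g` that are integrable with respect
to `|ν|`. -/
def integral (ν : LocalSignedMeasure) (g : ℝ → ℂ) : ℂ :=
  (∫ x, g x ∂ν.posPart) - ∫ x, g x ∂ν.negPart

/-! The measures `ν⁺`, `ν⁻`, `|ν|` have their defining properties. -/

lemma measurableSet_annulus (n : ℕ) : MeasurableSet (annulus n) := by
  unfold annulus
  have h1 : MeasurableSet {x : ℝ | 1 / ((n : ℝ) + 1) ≤ |x|} :=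
    measurableSet_le measurable_const continuous_abs.measurable
  have h2 : MeasurableSet {x : ℝ | |x| < 1 / (n : ℝ)} :=
    measurableSet_lt continuous_abs.measurable measurable_const
  exact h1.inter ((MeasurableSet.const _).union h2)

lemma disjoint_annulus_of_lt {m n : ℕ} (h : m < n) : Disjoint (annulus m) (annulus n) := by
  rw [Set.disjoint_left]
  rintro x ⟨h1, -⟩ ⟨-, h2⟩
  rcases h2 with h2 | h2
  · omega
  · have h3 : ((m : ℝ) + 1) ≤ n := by exact_mod_cast h
    have h4 : 1 / (n : ℝ) ≤ 1 / ((m : ℝ) + 1) := one_div_le_one_div_of_le (by positivity) h3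
    linarith

lemma pairwise_disjoint_annulus : Pairwise (Function.onFun Disjoint annulus) := by
  intro m n hmn
  rcases lt_or_gt_of_ne hmn with h | h
  · exact disjoint_annulus_of_lt h
  · exact (disjoint_annulus_of_lt h).symm

lemma iUnion_annulus : ⋃ n, annulus n = {0}ᶜ := by
  ext x
  simp only [mem_iUnion, mem_compl_iff, mem_singleton_iff]
  constructor
  · rintro ⟨n, h, -⟩ rfl
    have : 0 < 1 / ((n : ℝ) + 1) := by positivity
    simp only [abs_zero] at h
    linarith
  · intro hx
    have hx' : 0 < |x| := abs_pos.mpr hx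
    have hex : ∃ n : ℕ, 1 / ((n : ℝ) + 1) ≤ |x| := by
      obtain ⟨n, hn⟩ := exists_nat_one_div_lt hx'
      exact ⟨n, hn.le⟩
    classical
    refine ⟨Nat.find hex, Nat.find_spec hex, ?_⟩
    rcases hN : Nat.find hex with _ | k
    · exact Or.inl rfl
    · right
      have := Nat.find_min hex (m := k) (by omega)
      push_cast
      exact not_le.mp this

open scoped Classical in
lemma restr_eq_restrict (ν : LocalSignedMeasure) {s r : ℝ} (hs : 0 < s) (hsr : s ≤ r) :
    ν.restr r (hs.trans_le hsr) = (ν.restr s hs).restrict (Ioo (-r) r)ᶜ := by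
  ext B hB
  rw [VectorMeasure.restrict_apply _ measurableSet_Ioo.compl hB]
  have h2 : MeasurableSet (B ∩ (Ioo (-r) r)ᶜ) := hB.inter measurableSet_Ioo.compl
  change (if MeasurableSet B then _ else _) = if MeasurableSet (B ∩ (Ioo (-r) r)ᶜ) then _ else _
  rw [if_pos hB, if_pos h2]
  congr 1
  ext x
  simp only [mem_sdiff, mem_inter_iff, mem_compl_iff, mem_Ioo]
  constructor
  · rintro ⟨h, h'⟩
    exact ⟨⟨h, h'⟩, fun h'' => h' ⟨by linarith [h''.1], by linarith [h''.2]⟩⟩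
  · rintro ⟨h, -⟩
    exact h

/-- The Jordan decomposition of a restricted signed measure. -/
def jordanRestrict (j : JordanDecomposition ℝ) (E : Set ℝ) : JordanDecomposition ℝ where
  posPart := j.posPart.restrict E
  negPart := j.negPart.restrict E
  mutuallySingular := (j.mutuallySingular.restrict E).symm.restrict E |>.symm

lemma toJordanDecomposition_restrict (σ : SignedMeasure ℝ) {E : Set ℝ} (hE : MeasurableSet E) :
    SignedMeasure.toJordanDecomposition (σ.restrict E) = jordanRestrict σ.toJordanDecomposition E := by
  apply SignedMeasure.toJordanDecomposition_eq
  ext B hB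
  rw [VectorMeasure.restrict_apply _ hE hB,
    SignedMeasure.apply_eq_posPart_real_sub_negPart_real σ (hB.inter hE)]
  rw [JordanDecomposition.toSignedMeasure, Measure.toSignedMeasure_sub_apply hB]
  simp [jordanRestrict, measureReal_def, Measure.restrict_apply hB]

lemma inter_compl_Ioo {r : ℝ} {A : Set ℝ} (hA : A ∈ borelAway r) : A ∩ (Ioo (-r) r)ᶜ = A := by
  rw [inter_eq_left]
  intro x hx hx'
  have : x ∈ A ∩ Ioo (-r) r := ⟨hx, hx'⟩
  rw [hA.2] at this
  exact this

lemma restr_posPart_apply (ν : LocalSignedMeasure) {s r : ℝ} (hs : 0 < s) (hsr : s ≤ r)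
    {A : Set ℝ} (hA : A ∈ borelAway r) :
    (ν.restr r (hs.trans_le hsr)).toJordanDecomposition.posPart A =
      (ν.restr s hs).toJordanDecomposition.posPart A := by
  rw [restr_eq_restrict ν hs hsr, toJordanDecomposition_restrict _ measurableSet_Ioo.compl]
  change (Measure.restrict _ _) A = _
  rw [Measure.restrict_apply hA.1, inter_compl_Ioo hA]

lemma restr_negPart_apply (ν : LocalSignedMeasure) {s r : ℝ} (hs : 0 < s) (hsr : s ≤ r)
    {A : Set ℝ} (hA : A ∈ borelAway r) :
    (ν.restr r (hs.trans_le hsr)).toJordanDecomposition.negPart A =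
      (ν.restr s hs).toJordanDecomposition.negPart A := by
  rw [restr_eq_restrict ν hs hsr, toJordanDecomposition_restrict _ measurableSet_Ioo.compl]
  change (Measure.restrict _ _) A = _
  rw [Measure.restrict_apply hA.1, inter_compl_Ioo hA]

lemma inter_annulus_mem {A : Set ℝ} (hA : MeasurableSet A) (n : ℕ) :
    A ∩ annulus n ∈ borelAway (1 / ((n : ℝ) + 1)) := by
  refine ⟨hA.inter (measurableSet_annulus n), ?_⟩
  rw [Set.eq_empty_iff_forall_notMem]
  rintro x ⟨⟨-, h, -⟩, h2⟩
  exact absurd (abs_lt.mpr ⟨h2.1, h2.2⟩) (not_lt.mpr h)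

lemma borelAway_inter {r : ℝ} {A E : Set ℝ} (hA : A ∈ borelAway r) (hE : MeasurableSet E) :
    A ∩ E ∈ borelAway r :=
  ⟨hA.1.inter hE, by rw [inter_right_comm, hA.2, empty_inter]⟩

lemma glue_apply (m : ∀ r : ℝ, 0 < r → Measure ℝ)
    (hm : ∀ (s r : ℝ) (hs : 0 < s) (hsr : s ≤ r) (A : Set ℝ), A ∈ borelAway r →
      m r (hs.trans_le hsr) A = m s hs A)
    {r : ℝ} (hr : 0 < r) {A : Set ℝ} (hA : A ∈ borelAway r) :
    (Measure.sum fun n : ℕ =>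
      (m (1 / ((n : ℝ) + 1)) (by positivity)).restrict (annulus n)) A = m r hr A := by
  have key : ∀ n : ℕ, m (1 / ((n : ℝ) + 1)) (by positivity) (A ∩ annulus n) =
      m r hr (A ∩ annulus n) := by
    intro n
    have hn : (0 : ℝ) < 1 / ((n : ℝ) + 1) := by positivity
    rcases le_total (1 / ((n : ℝ) + 1)) r with h | h
    · exact (hm _ _ hn h _ (borelAway_inter hA (measurableSet_annulus n))).symm
    · exact hm _ _ hr h _ (inter_annulus_mem hA.1 n)
  rw [Measure.sum_apply _ hA.1]
  simp only [Measure.restrict_apply hA.1, key]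
  rw [← measure_iUnion, ← inter_iUnion, iUnion_annulus]
  · congr 1
    rw [inter_eq_left]
    rintro x hx rfl
    have : (0 : ℝ) ∈ A ∩ Ioo (-r) r := ⟨hx, by simpa using hr⟩
    rw [hA.2] at this
    exact this
  · exact fun i j hij => (pairwise_disjoint_annulus hij).mono inter_subset_right inter_subset_right
  · exact fun i => hA.1.inter (measurableSet_annulus i)

lemma glue_zero (m : ℕ → Measure ℝ) :
    (Measure.sum fun n : ℕ => (m n).restrict (annulus n)) {0} = 0 := by
  rw [Measure.sum_apply _ (measurableSet_singleton 0), ENNReal.tsum_eq_zero]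
  intro n
  rw [Measure.restrict_apply (measurableSet_singleton 0)]
  have : ({0} : Set ℝ) ∩ annulus n = ∅ := by
    rw [← disjoint_iff_inter_eq_empty, disjoint_singleton_left]
    intro h
    have : (0 : ℝ) ∈ ⋃ n, annulus n := mem_iUnion.mpr ⟨n, h⟩
    rw [iUnion_annulus] at this
    exact this rfl
  rw [this, measure_empty]

theorem posPart_singleton_zero (ν : LocalSignedMeasure) : ν.posPart {0} = 0 :=
  glue_zero _

theorem negPart_singleton_zero (ν : LocalSignedMeasure) : ν.negPart {0} = 0 :=
  glue_zero _

theorem totalVariation_singleton_zero (ν : LocalSignedMeasure) : ν.totalVariation {0} = 0 := by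
  simp [totalVariation, posPart_singleton_zero, negPart_singleton_zero]

theorem posPart_apply (ν : LocalSignedMeasure) {r : ℝ} (hr : 0 < r) {A : Set ℝ}
    (hA : A ∈ borelAway r) :
    ν.posPart A = (ν.restr r hr).toJordanDecomposition.posPart A :=
  glue_apply (fun r hr => (ν.restr r hr).toJordanDecomposition.posPart)
    (fun _ _ hs hsr _ hA => ν.restr_posPart_apply hs hsr hA) hr hA

theorem negPart_apply (ν : LocalSignedMeasure) {r : ℝ} (hr : 0 < r) {A : Set ℝ}
    (hA : A ∈ borelAway r) :
    ν.negPart A = (ν.restr r hr).toJordanDecomposition.negPart A :=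
  glue_apply (fun r hr => (ν.restr r hr).toJordanDecomposition.negPart)
    (fun _ _ hs hsr _ hA => ν.restr_negPart_apply hs hsr hA) hr hA

theorem totalVariation_apply (ν : LocalSignedMeasure) {r : ℝ} (hr : 0 < r) {A : Set ℝ}
    (hA : A ∈ borelAway r) :
    ν.totalVariation A = (ν.restr r hr).totalVariation A := by
  simp [totalVariation, SignedMeasure.totalVariation, posPart_apply ν hr hA, negPart_apply ν hr hA]

/-- `ν` is a quasi-Lévy type measure: `∫ (1 ∧ x²) |ν|(dx) < ∞`. -/
def IsQuasiLevyType (ν : LocalSignedMeasure) : Prop :=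
  ∫⁻ x, ENNReal.ofReal (min 1 (x ^ 2)) ∂ν.totalVariation < ∞

end LocalSignedMeasure

/-- The Lévy-Khintchine integrand `e^{ixz} - 1 - ixz 1_{[-1,1]}(x)`. -/
def levyKernel (z x : ℝ) : ℂ :=
  Complex.exp (Complex.I * x * z) - 1 -
    Complex.I * x * z * (Icc (-1 : ℝ) 1).indicator (fun _ => (1 : ℂ)) x

/-- `(a, γ, ν)` is a characteristic triplet of `μ`: `ν` is a quasi-Lévy type measure and the
characteristic function of `μ` has the Lévy-Khintchine representation with `(a, γ, ν)`. -/
def HasCharacteristicTriplet (μ : Measure ℝ) (a γ : ℝ) (ν : LocalSignedMeasure) : Prop :=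
  ν.IsQuasiLevyType ∧
    ∀ z : ℝ, charFun μ z =
      Complex.exp (-(1 / 2 : ℂ) * a * z ^ 2 + Complex.I * γ * z + ν.integral (levyKernel z))

/-- A distribution on `ℝ` is quasi-infinitely divisible if its characteristic function has a
Lévy-Khintchine representation with `a, γ ∈ ℝ` and a quasi-Lévy type measure `ν`. -/
def IsQuasiInfinitelyDivisible (μ : Measure ℝ) : Prop :=
  ∃ (a γ : ℝ) (ν : LocalSignedMeasure), HasCharacteristicTriplet μ a γ ν

/-- The lattice `r + hℤ`. -/
def lattice (r h : ℝ) : Set ℝ :=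
  range fun k : ℤ => r + h * k

end QuasiInfDiv

end

/-!
Write `φ`, `D` and `F` for the Fourier transforms of `μ`, of its lattice part and of its absolutely
continuous part, so that `φ = D + F = D (1 + F/D)`. A quasi-infinitely divisible law has a zero-free
`φ`, as an exponential has no zeros. Conversely, suppose that `D` and `φ` are zero-free. The heart of
the matter is a theorem of Wiener–Lévy type: up to winding, the logarithms of `D` and of `1 + F/D`
are Fourier transforms of complex measures.

For this Newman's elementary proof of Wiener's lemma is followed. A function `g` which is bounded
away from zero is approximated, in the norm given by the total variation of the complex measure, by
a smooth function `P`; then `g = P (1 + (g - P)/P)`, and the logarithm of the second factor is a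
power series whose terms are controlled by the derivatives of the powers of `1/P`
(`FourierBound.exists_log_div`). Smooth functions are Fourier transforms of complex measures, by
Fourier series in the periodic case (`FourierBound.exists_of_periodic`) and by Fourier inversion on
the line (`FourierBound.of_decay`); this also deals with `log P`, once its winding has been removed.
On the circle the winding is removed by a linear function, that is, by a shift of the measure
(`exists_log_charFun_lattice`). On the line it is removed by a multiple of a function increasing from
`-π` to `π`, for which the primitive of a Gaussian density is chosen; `i` times this function is a
Lévy–Khintchine exponent with the density `e^{-x²/2}/x`, which integrates `|x|` near zero but is not
integrable (`exists_log_one_add`, `integral_osc_sub_one_mul_gauss`).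

Altogether `φ(z) = exp (iγz + ∫ (e^{ixz} - 1) ν(dx))` for a complex `ν` that integrates `1 ∧ |x|`.
Since `φ(-z)` is the conjugate of `φ(z)` and continuous logarithms are unique, `ν` may be replaced by
its real part, a difference of two positive measures (`exists_levy_pair`). This is a characteristic
triplet with Gaussian variance zero.

Every other triplet has the same exponent. Second differences of the exponent with step sizes `1` and
`√2` turn the Lévy measures into finite measures and the Gaussian variance into a point mass at `0`,
so that the injectivity of the Fourier transform applies (`levy_uniqueness`). Hence the Gaussian
variance vanishes, and by the minimality of the Jordan decomposition `|ν|` is dominated by a measure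
that integrates `1 ∧ |x|` (`LocalSignedMeasure.posPart_le_and_negPart_le`).
-/

noncomputable section

namespace QuasiInfDiv

open Filter Topology Complex

/-! ### Fourier transforms of complex measures -/

/-- The character `z ↦ e^{ixz}` of the real line. -/
def osc (x z : ℝ) : ℂ := Complex.exp ((x * z : ℝ) * I)

@[simp] lemma norm_osc (x z : ℝ) : ‖osc x z‖ = 1 := norm_exp_ofReal_mul_I _

@[simp] lemma enorm_osc (x z : ℝ) : ‖osc x z‖ₑ = 1 := by
  rw [← ofReal_norm, norm_osc, ENNReal.ofReal_one]

lemma osc_add_left (x y z : ℝ) : osc (x + y) z = osc x z * osc y z := by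
  rw [osc, osc, osc, ← Complex.exp_add]
  congr 1
  push_cast
  ring

lemma osc_add_right (x z w : ℝ) : osc x (z + w) = osc x z * osc x w := by
  rw [osc, osc, osc, ← Complex.exp_add]
  congr 1
  push_cast
  ring

@[simp] lemma osc_zero_left (z : ℝ) : osc 0 z = 1 := by simp [osc]

@[simp] lemma osc_zero_right (x : ℝ) : osc x 0 = 1 := by simp [osc]

lemma continuous_osc_left (z : ℝ) : Continuous fun x => osc x z := by
  unfold osc
  fun_prop

lemma continuous_osc_right (x : ℝ) : Continuous fun z => osc x z := by
  unfold osc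
  fun_prop

lemma hasDerivAt_osc (x z : ℝ) : HasDerivAt (fun z => osc x z) (osc x z * (I * x)) z := by
  unfold osc
  have h1 : HasDerivAt (fun z : ℝ => ((x * z : ℝ) : ℂ) * I) ((x : ℂ) * I) z := by
    have : HasDerivAt (fun z : ℝ => x * z) x z := by
      simpa using (hasDerivAt_id z).const_mul x
    exact this.ofReal_comp.mul_const I
  convert! h1.cexp using 1
  ring

/-- `ψ` is the Fourier transform of a complex measure of total variation at most `C`. The complex
measure is encoded as a positive measure `m` on pairs `(x, c)` of a position and a charge: it is
the image of `c m(dx, dc)` under the first projection. In this form sums, convolutions and series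
of complex measures are given by sums, products and series of positive measures. -/
def FourierBound (ψ : ℝ → ℂ) (C : ℝ) : Prop :=
  ∃ m : Measure (ℝ × ℂ), SFinite m ∧ ∫⁻ p, ‖p.2‖ₑ ∂m ≤ ENNReal.ofReal C ∧
    ∀ z, ψ z = ∫ p, osc p.1 z * p.2 ∂m

lemma integrable_osc_mul {Ω : Type*} [MeasurableSpace Ω] {μ : Measure Ω} {X : Ω → ℝ} {k : Ω → ℂ}
    (hX : AEMeasurable X μ) (hk : Integrable k μ) (z : ℝ) :
    Integrable (fun ω => osc (X ω) z * k ω) μ := by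
  refine hk.bdd_mul (c := 1) ?_ (by simp)
  exact ((continuous_osc_left z).measurable.comp_aemeasurable hX).aestronglyMeasurable

lemma integrable_snd_of_lintegral {m : Measure (ℝ × ℂ)} {C : ℝ}
    (h : ∫⁻ p, ‖p.2‖ₑ ∂m ≤ ENNReal.ofReal C) : Integrable (fun p : ℝ × ℂ => p.2) m :=
  ⟨measurable_snd.aestronglyMeasurable, h.trans_lt ENNReal.ofReal_lt_top⟩

namespace FourierBound

variable {ψ φ : ℝ → ℂ} {C D : ℝ}

/-- Pushing forward along `ω ↦ (X ω, k ω)` gives the measure on pairs of the definition, so that any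
superposition of characters may serve as a representation. -/
lemma of_integral {Ω : Type*} [MeasurableSpace Ω] (μ : Measure Ω) [SFinite μ] {X : Ω → ℝ}
    {k : Ω → ℂ} (hX : AEMeasurable X μ) (hk : AEMeasurable k μ)
    (hC : ∫⁻ ω, ‖k ω‖ₑ ∂μ ≤ ENNReal.ofReal C) (h : ∀ z, ψ z = ∫ ω, osc (X ω) z * k ω ∂μ) :
    FourierBound ψ C := by
  refine ⟨μ.map fun ω => (X ω, k ω), inferInstance, ?_, fun z => ?_⟩
  · rwa [lintegral_map' (by fun_prop) (hX.prodMk hk)]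
  · rw [h, integral_map (hX.prodMk hk)]
    exact (((continuous_osc_left z).measurable.comp measurable_fst).mul
      measurable_snd).aestronglyMeasurable

lemma congr (h : FourierBound ψ C) (hψ : ∀ z, φ z = ψ z) : FourierBound φ C := by
  rwa [show φ = ψ from funext hψ]

lemma mono (h : FourierBound ψ C) (hCD : C ≤ D) : FourierBound ψ D := by
  obtain ⟨m, h1, h2, h3⟩ := h
  exact ⟨m, h1, h2.trans (ENNReal.ofReal_le_ofReal hCD), h3⟩

lemma norm_le (h : FourierBound ψ C) (hC : 0 ≤ C) (z : ℝ) : ‖ψ z‖ ≤ C := by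
  obtain ⟨m, -, h2, h3⟩ := h
  rw [h3, ← toReal_enorm]
  refine ENNReal.toReal_le_of_le_ofReal hC ((enorm_integral_le_lintegral_enorm _).trans ?_)
  simpa [enorm_mul] using h2

lemma continuous (h : FourierBound ψ C) : Continuous ψ := by
  obtain ⟨m, -, h2, h3⟩ := h
  have hi := integrable_snd_of_lintegral h2
  rw [show ψ = _ from funext h3]
  refine continuous_of_dominated (bound := fun p => ‖p.2‖)
    (fun z => (integrable_osc_mul measurable_fst.aemeasurable hi z).aestronglyMeasurable) ?_
    hi.norm ?_
  · simp
  · exact .of_forall fun p => (continuous_osc_right p.1).mul continuous_const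

lemma osc_mul (x : ℝ) (c : ℂ) : FourierBound (fun z => osc x z * c) ‖c‖ := by
  refine of_integral (Measure.dirac ()) (X := fun _ => x) (k := fun _ => c) (by fun_prop)
    (by fun_prop) ?_ (by simp)
  simp

lemma const (c : ℂ) : FourierBound (fun _ => c) ‖c‖ := by
  simpa using osc_mul 0 c

lemma add (h : FourierBound ψ C) (h' : FourierBound φ D) (hC : 0 ≤ C) (hD : 0 ≤ D) :
    FourierBound (fun z => ψ z + φ z) (C + D) := by
  obtain ⟨m, h1, h2, h3⟩ := h
  obtain ⟨m', h1', h2', h3'⟩ := h'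
  refine ⟨m + m', inferInstance, ?_, fun z => ?_⟩
  · rw [lintegral_add_measure, ENNReal.ofReal_add hC hD]
    gcongr
  · beta_reduce
    rw [h3, h3', integral_add_measure]
    · exact integrable_osc_mul measurable_fst.aemeasurable (integrable_snd_of_lintegral h2) z
    · exact integrable_osc_mul measurable_fst.aemeasurable (integrable_snd_of_lintegral h2') z

lemma mul (h : FourierBound ψ C) (h' : FourierBound φ D) (hC : 0 ≤ C) :
    FourierBound (fun z => ψ z * φ z) (C * D) := by
  obtain ⟨m, h1, h2, h3⟩ := h
  obtain ⟨m', h1', h2', h3'⟩ := h'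
  refine of_integral (m.prod m') (X := fun q => q.1.1 + q.2.1) (k := fun q => q.1.2 * q.2.2)
    (by fun_prop) (by fun_prop) ?_ fun z => ?_
  · simp only [enorm_mul]
    rw [lintegral_prod_mul (f := fun p : ℝ × ℂ => ‖p.2‖ₑ) (g := fun p : ℝ × ℂ => ‖p.2‖ₑ)
      (by fun_prop) (by fun_prop), ENNReal.ofReal_mul hC]
    gcongr
  · rw [h3, h3', ← integral_prod_mul]
    refine integral_congr_ae (.of_forall fun q => ?_)
    simp only [osc_add_left]
    ring

lemma const_mul (c : ℂ) (h : FourierBound ψ C) :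
    FourierBound (fun z => c * ψ z) (‖c‖ * C) :=
  (const c).mul h (norm_nonneg _)

lemma neg (h : FourierBound ψ C) : FourierBound (fun z => -ψ z) C := by
  simpa using h.const_mul (-1)

lemma pow (h : FourierBound ψ C) (hC : 0 ≤ C) (n : ℕ) :
    FourierBound (fun z => ψ z ^ n) (C ^ n) := by
  induction n with
  | zero => simpa using const 1
  | succ n ih => simpa only [pow_succ] using ih.mul h (by positivity)

lemma tsum {ι : Type*} [Countable ι] {ψ : ι → ℝ → ℂ} {C : ι → ℝ}
    (h : ∀ n, FourierBound (ψ n) (C n)) (hC : ∀ n, 0 ≤ C n) (hs : Summable C) :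
    FourierBound (fun z => ∑' n, ψ n z) (∑' n, C n) := by
  choose m h1 h2 h3 using h
  have hb : ∫⁻ p, ‖p.2‖ₑ ∂(Measure.sum m) ≤ ENNReal.ofReal (∑' n, C n) := by
    rw [lintegral_sum_measure, ENNReal.ofReal_tsum_of_nonneg hC hs]
    exact ENNReal.tsum_le_tsum h2
  refine ⟨Measure.sum m, inferInstance, hb, fun z => ?_⟩
  rw [integral_sum_measure]
  · simp only [h3]
  · exact integrable_osc_mul measurable_fst.aemeasurable (integrable_snd_of_lintegral hb) z

lemma exp (h : FourierBound ψ C) (hC : 0 ≤ C) :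
    FourierBound (fun z => Complex.exp (ψ z)) (Real.exp C) := by
  have hs : HasSum (fun n : ℕ => ‖((n.factorial : ℂ))⁻¹‖ * C ^ n) (Real.exp C) := by
    rw [Real.exp_eq_exp_ℝ]
    simpa using NormedSpace.exp_series_hasSum_exp' (𝕂 := ℝ) C
  have := tsum (fun n : ℕ => (h.pow hC n).const_mul ((n.factorial : ℂ))⁻¹)
    (fun n => by positivity) hs.summable
  rw [hs.tsum_eq] at this
  refine this.congr fun z => ?_
  rw [Complex.exp_eq_exp_ℂ, NormedSpace.exp_eq_tsum ℂ]
  rfl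

end FourierBound

/-! ### Twice differentiable functions and the logarithmic series -/

/-- `P` is twice continuously differentiable with derivatives `P'` and `P''`, which are bounded
by `B * ρ`. -/
structure C2Bound (P P' P'' : ℝ → ℂ) (B : ℝ) (ρ : ℝ → ℝ) : Prop where
  hasDerivAt : ∀ z, HasDerivAt P (P' z) z
  hasDerivAt' : ∀ z, HasDerivAt P' (P'' z) z
  continuous'' : Continuous P''
  norm_le' : ∀ z, ‖P' z‖ ≤ B * ρ z
  norm_le'' : ∀ z, ‖P'' z‖ ≤ B * ρ z

namespace C2Bound

variable {P P' P'' Q Q' Q'' : ℝ → ℂ} {B : ℝ} {ρ : ℝ → ℝ}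

lemma continuous (h : C2Bound P P' P'' B ρ) : Continuous P :=
  continuous_iff_continuousAt.2 fun z => (h.hasDerivAt z).continuousAt

lemma continuous' (h : C2Bound P P' P'' B ρ) : Continuous P' :=
  continuous_iff_continuousAt.2 fun z => (h.hasDerivAt' z).continuousAt

lemma inv {c : ℝ} (h : C2Bound P P' P'' B ρ) (hB : 0 ≤ B) (hc : 0 < c) (hP : ∀ z, c ≤ ‖P z‖)
    (hρ : ∀ z, 0 ≤ ρ z) (hρ1 : ∀ z, ρ z ≤ 1) :
    C2Bound (fun z => (P z)⁻¹) (fun z => -P' z * (P z)⁻¹ ^ 2)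
      (fun z => -P'' z * (P z)⁻¹ ^ 2 + 2 * P' z ^ 2 * (P z)⁻¹ ^ 3)
      (B * c⁻¹ ^ 2 + 2 * B ^ 2 * c⁻¹ ^ 3) ρ := by
  have hne : ∀ z, P z ≠ 0 := fun z => norm_pos_iff.1 (hc.trans_le (hP z))
  have hinv : ∀ z, ‖(P z)⁻¹‖ ≤ c⁻¹ := fun z => by
    rw [norm_inv]
    exact inv_anti₀ hc (hP z)
  have h1 : ∀ z, HasDerivAt (fun z => (P z)⁻¹) (-P' z * (P z)⁻¹ ^ 2) z := fun z => by
    convert! (h.hasDerivAt z).fun_inv (hne z) using 1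
    field_simp
  have hcont : Continuous fun z => (P z)⁻¹ := h.continuous.inv₀ hne
  have e1 : ∀ z, ‖P' z * (P z)⁻¹ ^ 2‖ ≤ B * c⁻¹ ^ 2 * ρ z := fun z => by
    rw [norm_mul, norm_pow, mul_right_comm]
    have := hρ z
    gcongr
    · exact h.norm_le' z
    · exact hinv z
  have e2 : ∀ z, ‖P'' z * (P z)⁻¹ ^ 2‖ ≤ B * c⁻¹ ^ 2 * ρ z := fun z => by
    rw [norm_mul, norm_pow, mul_right_comm]
    have := hρ z
    gcongr
    · exact h.norm_le'' z
    · exact hinv z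
  have e3 : ∀ z, ‖2 * P' z ^ 2 * (P z)⁻¹ ^ 3‖ ≤ 2 * B ^ 2 * c⁻¹ ^ 3 * ρ z := fun z => by
    have h0 := hρ z
    calc ‖2 * P' z ^ 2 * (P z)⁻¹ ^ 3‖ = 2 * ‖P' z‖ ^ 2 * ‖(P z)⁻¹‖ ^ 3 := by simp
      _ ≤ 2 * (B * ρ z) ^ 2 * c⁻¹ ^ 3 := by
          gcongr
          · exact h.norm_le' z
          · exact hinv z
      _ = 2 * B ^ 2 * c⁻¹ ^ 3 * (ρ z * ρ z) := by ring
      _ ≤ 2 * B ^ 2 * c⁻¹ ^ 3 * ρ z := by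
          gcongr
          exact mul_le_of_le_one_left h0 (hρ1 z)
  refine ⟨h1, fun z => ?_, ?_, fun z => ?_, fun z => ?_⟩
  · convert! (h.hasDerivAt' z).neg.mul ((h1 z).pow 2) using 1
    simp only [Pi.neg_apply, Pi.pow_apply]
    push_cast
    ring
  · have := h.continuous'
    have := h.continuous''
    fun_prop
  · rw [neg_mul, norm_neg]
    have : 0 ≤ 2 * B ^ 2 * c⁻¹ ^ 3 * ρ z := by
      have := hρ z
      positivity
    linarith [e1 z]
  · refine (norm_add_le _ _).trans ?_
    rw [neg_mul, norm_neg]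
    linarith [e2 z, e3 z]

/-- The bound grows with `n` no faster than `n ^ 2 * M ^ n`, where `M` bounds the function itself
and not its derivatives: this is what makes the logarithmic series converge in total variation. -/
lemma pow {M : ℝ} (h : C2Bound P P' P'' B ρ) (hB : 0 ≤ B) (hM : 1 ≤ M) (hP : ∀ z, ‖P z‖ ≤ M)
    (hρ : ∀ z, 0 ≤ ρ z) (hρ1 : ∀ z, ρ z ≤ 1) (n : ℕ) :
    C2Bound (fun z => P z ^ n) (fun z => n * P z ^ (n - 1) * P' z)
      (fun z => n * ((n - 1 : ℕ) * P z ^ (n - 1 - 1) * P' z * P' z + P z ^ (n - 1) * P'' z))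
      ((B + B ^ 2) * ((n + 1) ^ 2 * M ^ n)) ρ := by
  have hpow : ∀ z, ∀ j ≤ n, ‖P z ^ j‖ ≤ M ^ n := fun z j hj => by
    rw [norm_pow]
    exact (pow_le_pow_left₀ (norm_nonneg _) (hP z) j).trans (pow_le_pow_right₀ hM hj)
  have hn1 : ((n - 1 : ℕ) : ℝ) ≤ n := by exact_mod_cast Nat.sub_le n 1
  refine ⟨fun z => (h.hasDerivAt z).pow n, fun z => ?_, ?_, fun z => ?_, fun z => ?_⟩
  · convert! (((h.hasDerivAt z).pow (n - 1)).mul (h.hasDerivAt' z)).const_mul (n : ℂ) using 1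
    · ext z
      simp only [Pi.mul_apply, Pi.pow_apply]
      ring
  · have := h.continuous
    have := h.continuous'
    have := h.continuous''
    fun_prop
  · have h0 := hρ z
    calc ‖n * P z ^ (n - 1) * P' z‖ = n * ‖P z ^ (n - 1)‖ * ‖P' z‖ := by simp
      _ ≤ n * M ^ n * (B * ρ z) := by
          gcongr
          · exact hpow z _ (by omega)
          · exact h.norm_le' z
      _ = n * B * (M ^ n * ρ z) := by ring
      _ ≤ ((n + 1) ^ 2 * (B + B ^ 2)) * (M ^ n * ρ z) := by
          gcongr
          · nlinarith [(Nat.cast_nonneg n : (0 : ℝ) ≤ n)]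
          · nlinarith
      _ = _ := by ring
  · have h0 := hρ z
    calc ‖n * ((n - 1 : ℕ) * P z ^ (n - 1 - 1) * P' z * P' z + P z ^ (n - 1) * P'' z)‖
        ≤ n * ((n - 1 : ℕ) * ‖P z ^ (n - 1 - 1)‖ * ‖P' z‖ * ‖P' z‖
            + ‖P z ^ (n - 1)‖ * ‖P'' z‖) := by
          rw [norm_mul, Complex.norm_natCast]
          gcongr
          refine (norm_add_le _ _).trans (le_of_eq ?_)
          simp
      _ ≤ n * (n * M ^ n * (B * ρ z) * (B * 1) + M ^ n * (B * ρ z)) := by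
          gcongr
          · exact hpow z _ (by omega)
          · exact h.norm_le' z
          · exact (h.norm_le' z).trans (by gcongr; exact hρ1 z)
          · exact hpow z _ (by omega)
          · exact h.norm_le'' z
      _ = (n ^ 2 * B ^ 2 + n * B) * (M ^ n * ρ z) := by ring
      _ ≤ ((n + 1) ^ 2 * (B + B ^ 2)) * (M ^ n * ρ z) := by
          gcongr
          have hn : (0 : ℝ) ≤ n := Nat.cast_nonneg n
          nlinarith [mul_nonneg hn hB, mul_nonneg hn (sq_nonneg B),
            mul_nonneg (sq_nonneg (n : ℝ)) hB, sq_nonneg B]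
      _ = _ := by ring

/-- A zero-free `C²` function has a `C²` logarithm. -/
lemma exists_log (h : C2Bound P P' P'' B ρ) (hP : ∀ z, P z ≠ 0) :
    ∃ v : ℝ → ℂ, (∀ z, HasDerivAt v (P' z * (P z)⁻¹) z) ∧ ∀ z, P z = Complex.exp (v z) := by
  have hc : Continuous fun z => P' z * (P z)⁻¹ := h.continuous'.mul (h.continuous.inv₀ hP)
  refine ⟨fun z => Complex.log (P 0) + ∫ t in (0 : ℝ)..z, P' t * (P t)⁻¹, fun z => ?_, ?_⟩
  · exact (intervalIntegral.integral_hasDerivAt_right (hc.intervalIntegrable _ _)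
      (hc.stronglyMeasurableAtFilter _ _) hc.continuousAt).const_add _
  set v := fun z => Complex.log (P 0) + ∫ t in (0 : ℝ)..z, P' t * (P t)⁻¹ with hv
  have hvd : ∀ z, HasDerivAt v (P' z * (P z)⁻¹) z := fun z =>
    (intervalIntegral.integral_hasDerivAt_right (hc.intervalIntegrable _ _)
      (hc.stronglyMeasurableAtFilter _ _) hc.continuousAt).const_add _
  have hd : ∀ z, HasDerivAt (fun z => P z * Complex.exp (-v z)) 0 z := fun z => by
    convert! (h.hasDerivAt z).mul (hvd z).neg.cexp using 1
    have := hP z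
    simp only [Pi.neg_apply]
    field_simp
    ring
  have hconst : ∀ z, P z * Complex.exp (-v z) = P 0 * Complex.exp (-v 0) := fun z =>
    is_const_of_deriv_eq_zero (fun z => (hd z).differentiableAt) (fun z => (hd z).deriv) z 0
  intro z
  have h0 : P 0 * Complex.exp (-v 0) = 1 := by
    simp only [hv, intervalIntegral.integral_same, add_zero]
    rw [Complex.exp_neg, Complex.exp_log (hP 0), mul_inv_cancel₀ (hP 0)]
  have := hconst z
  rw [h0, Complex.exp_neg, mul_inv_eq_one₀ (Complex.exp_ne_zero _)] at this
  exact this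

end C2Bound

namespace FourierBound

/-- The logarithm of a zero-free function `φ` close to `P`, where the powers of `1/P` are under
control: in `φ = P * (1 + (φ - P)/P)` the logarithm of the second factor is given by its power
series. This is the step by which Newman proved Wiener's lemma. -/
lemma exists_log_div {φ P : ℝ → ℂ} {ε K M : ℝ} (hP : ∀ z, P z ≠ 0) (hε : 0 ≤ ε) (hK : 0 ≤ K)
    (hM : 0 ≤ M) (hPM : ∀ z, ‖(P z)⁻¹‖ ≤ M) (hE : FourierBound (fun z => φ z - P z) ε)
    (hQ : ∀ n : ℕ, FourierBound (fun z => (P z)⁻¹ ^ n) (K * ((n + 1) ^ 2 * M ^ n)))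
    (hεM : ε * M < 1) :
    ∃ w C, 0 ≤ C ∧ FourierBound w C ∧ ∀ z, φ z = P z * Complex.exp (w z) := by
  set a : ℕ → ℂ := fun n => (-1) ^ (n + 1) / n with ha
  set C : ℕ → ℝ := fun n => ‖a n‖ * (ε ^ n * (K * ((n + 1) ^ 2 * M ^ n))) with hC
  have hC0 : ∀ n, 0 ≤ C n := fun n => by positivity
  have hterm : ∀ n, FourierBound (fun z => a n * ((φ z - P z) ^ n * (P z)⁻¹ ^ n)) (C n) :=
    fun n => ((hE.pow hε n).mul (hQ n) (by positivity)).const_mul _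
  have hsum : Summable C := by
    have hr : ‖ε * M‖ < 1 := by rwa [Real.norm_of_nonneg (by positivity)]
    have s2 := summable_pow_mul_geometric_of_norm_lt_one 2 hr
    have s1 := summable_pow_mul_geometric_of_norm_lt_one 1 hr
    have s0 := summable_pow_mul_geometric_of_norm_lt_one 0 hr
    refine Summable.of_nonneg_of_le hC0 (fun n => ?_)
      ((((s2.add (s1.mul_left 2)).add s0)).mul_left K)
    have han : ‖a n‖ ≤ 1 := by
      simp only [ha, norm_div, norm_pow, norm_neg, norm_one, one_pow, Complex.norm_natCast]
      rcases Nat.eq_zero_or_pos n with rfl | hn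
      · simp
      · rw [div_le_one (by positivity)]
        exact_mod_cast hn
    calc C n ≤ 1 * (ε ^ n * (K * ((n + 1) ^ 2 * M ^ n))) := by
          simp only [hC]
          gcongr
      _ = _ := by
          rw [mul_pow]
          ring
  refine ⟨_, _, tsum_nonneg hC0, FourierBound.tsum hterm hC0 hsum, fun z => ?_⟩
  have hx : ‖(φ z - P z) * (P z)⁻¹‖ < 1 := by
    rw [norm_mul]
    refine lt_of_le_of_lt ?_ hεM
    gcongr
    · exact hE.norm_le hε z
    · exact hPM z
  have hs := (Complex.hasSum_taylorSeries_log hx).tsum_eq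
  have he : ∑' n, a n * ((φ z - P z) ^ n * (P z)⁻¹ ^ n)
      = Complex.log (1 + (φ z - P z) * (P z)⁻¹) := by
    rw [← hs]
    refine tsum_congr fun n => ?_
    rw [ha, mul_pow]
    ring
  have hne : 1 + (φ z - P z) * (P z)⁻¹ ≠ 0 := fun h0 => by
    rw [add_eq_zero_iff_eq_neg'] at h0
    simp [h0] at hx
  rw [he, Complex.exp_log hne]
  have := hP z
  field_simp
  ring

end FourierBound

/-! ### Fourier transforms of complex measures: smooth functions -/

namespace FourierBound

/-- A periodic `C²` function is the Fourier transform of a discrete complex measure, since its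
Fourier coefficients are `O(1/n²)`. -/
lemma exists_of_periodic {T : ℝ} (hT : 0 < T) :
    ∃ K : ℝ, 0 ≤ K ∧ ∀ (s s' s'' : ℝ → ℂ) (B : ℝ), 0 ≤ B → Function.Periodic s T →
      C2Bound s s' s'' B (fun _ => 1) → (∀ z, ‖s z‖ ≤ B) → FourierBound s (K * B) := by
  set a : ℤ → ℝ := fun n => (if n = 0 then 1 else 0) + (T / (2 * Real.pi * n)) ^ 2 with ha
  have ha0 : ∀ n, 0 ≤ a n := fun n => by
    simp only [ha]
    split_ifs <;> positivity
  have hsum : Summable a := by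
    refine Summable.add (summable_of_hasFiniteSupport ?_) ?_
    · exact (Set.finite_singleton (0 : ℤ)).subset fun n hn => by
        by_contra h
        simp at h
        simp [h] at hn
    · have h2 : Summable fun n : ℤ => 1 / (n : ℝ) ^ 2 :=
        Real.summable_one_div_int_pow.2 one_lt_two
      refine (h2.mul_left ((T / (2 * Real.pi)) ^ 2)).congr fun n => ?_
      rw [mul_one_div, ← div_pow, div_div]
  refine ⟨∑' n, a n, tsum_nonneg ha0, fun s s' s'' B hB hper h hs => ?_⟩
  have : Fact (0 < T) := ⟨hT⟩
  have hT0 : (0 : ℝ) < 0 + T := by simpa using hT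
  set f : C(AddCircle T, ℂ) := ⟨hper.lift, by
    exact continuous_coinduced_dom.mpr h.continuous⟩ with hf
  have hfs : ∀ z : ℝ, f (z : AddCircle T) = s z := fun z => hper.lift_coe z
  have hcoefInt : ∀ n : ℤ, ∀ g : ℝ → ℂ,
      fourierCoeffOn hT0 g n = (1 / T : ℝ) • ∫ x in (0 : ℝ)..T,
        fourier (-n) (x : AddCircle (0 + T - 0)) • g x := fun n g => by
    rw [fourierCoeffOn_eq_integral]
    simp
  have hcoefBound : ∀ n : ℤ, ∀ g : ℝ → ℂ, (∀ z, ‖g z‖ ≤ B) → ‖fourierCoeffOn hT0 g n‖ ≤ B :=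
    fun n g hg => by
      rw [hcoefInt, norm_smul, Real.norm_of_nonneg (by positivity)]
      have : ‖∫ x in (0 : ℝ)..T, fourier (-n) (x : AddCircle (0 + T - 0)) • g x‖
          ≤ B * |T - 0| := by
        refine intervalIntegral.norm_integral_le_of_norm_le_const fun x _ => ?_
        rw [norm_smul, fourier_apply, Circle.norm_coe, one_mul]
        exact hg x
      rw [show |T - 0| = T by simp [abs_of_pos hT]] at this
      calc _ ≤ 1 / T * (B * T) := by gcongr
        _ = B := by field_simp
  have hcoef : ∀ n : ℤ, fourierCoeff f n = fourierCoeffOn hT0 s n := fun n => by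
    rw [hcoefInt, fourierCoeff_eq_intervalIntegral _ _ 0, zero_add]
    congr 1
    refine intervalIntegral.integral_congr fun x _ => ?_
    rw [hfs, fourier_coe_apply, fourier_coe_apply, sub_zero]
  have hper' : s' T = s' 0 := by
    have h1 := h.hasDerivAt T
    have h2 : HasDerivAt (fun z => s (z + T)) (s' T) 0 := by
      have := HasDerivAt.comp_add_const (f := s) 0 T (by simpa using h1)
      exact this
    have h3 : (fun z => s (z + T)) = s := funext hper
    rw [h3] at h2
    exact h2.unique (h.hasDerivAt 0)
  have hbound : ∀ n : ℤ, ‖fourierCoeff f n‖ ≤ a n * B := fun n => by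
    rw [hcoef]
    by_cases hn : n = 0
    · simpa [ha, hn] using hcoefBound 0 s hs
    · have e1 := fourierCoeffOn_of_hasDerivAt hT0 hn (fun x _ => h.hasDerivAt x)
        (h.continuous'.intervalIntegrable 0 (0 + T))
      have e2 := fourierCoeffOn_of_hasDerivAt hT0 hn (fun x _ => h.hasDerivAt' x)
        (h.continuous''.intervalIntegrable 0 (0 + T))
      have hsT : s (0 + T) - s 0 = 0 := by rw [hper 0, sub_self]
      have hsT' : s' (0 + T) - s' 0 = 0 := by rw [zero_add, hper', sub_self]
      rw [hsT, mul_zero, zero_sub] at e1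
      rw [hsT', mul_zero, zero_sub] at e2
      rw [e1, e2]
      have hb := hcoefBound n s'' fun z => by simpa using h.norm_le'' z
      generalize fourierCoeffOn hT0 s'' n = y at hb ⊢
      have hn' : (0 : ℝ) < |(n : ℝ)| := by simpa using hn
      simp only [norm_mul, norm_neg, norm_div, norm_one, Complex.norm_intCast]
      have hT' : ‖(((0 + T : ℝ) : ℂ) - ((0 : ℝ) : ℂ))‖ = T := by
        simp [abs_of_pos hT]
      rw [hT']
      simp only [Complex.norm_ofNat, Complex.norm_real, Complex.norm_I,
        Real.norm_of_nonneg Real.pi_pos.le]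
      simp only [ha, hn, if_false, zero_add]
      calc _ ≤ 1 / (2 * Real.pi * 1 * |(n : ℝ)|) * (T * (1 / (2 * Real.pi * 1 * |(n : ℝ)|)
            * (T * B))) := by gcongr
        _ = (T / (2 * Real.pi * |(n : ℝ)|)) ^ 2 * B := by
          field_simp
        _ = _ := by
          rw [div_pow, div_pow, mul_pow _ |(n : ℝ)|, sq_abs, ← mul_pow]
  have hsummable : Summable (fourierCoeff f) :=
    Summable.of_norm_bounded (hsum.mul_right B) hbound
  have hfin := FourierBound.tsum (C := fun n => a n * B)
    (fun n : ℤ => (osc_mul (2 * Real.pi * n / T) (fourierCoeff f n)).mono (hbound n))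
    (fun n => mul_nonneg (ha0 n) hB) (hsum.mul_right B)
  rw [tsum_mul_right] at hfin
  refine hfin.congr fun z => ?_
  have := (has_pointwise_sum_fourier_series_of_summable hsummable (z : AddCircle T)).tsum_eq
  rw [hfs] at this
  rw [← this]
  refine tsum_congr fun n => ?_
  rw [fourier_coe_apply, osc, smul_eq_mul, mul_comm]
  congr 2
  push_cast
  ring

lemma integrable_of_le_inv_one_add_sq {s : ℝ → ℂ} {B : ℝ} (hs : Continuous s)
    (h : ∀ z, ‖s z‖ ≤ B * (1 + z ^ 2)⁻¹) : Integrable s :=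
  (integrable_inv_one_add_sq.const_mul B).mono' hs.aestronglyMeasurable (.of_forall h)

lemma integral_norm_le_of_le_inv_one_add_sq {s : ℝ → ℂ} {B : ℝ} (hs : Continuous s)
    (h : ∀ z, ‖s z‖ ≤ B * (1 + z ^ 2)⁻¹) : ∫ z, ‖s z‖ ≤ B * Real.pi := by
  rw [← integral_univ_inv_one_add_sq, ← integral_const_mul]
  exact integral_mono (integrable_of_le_inv_one_add_sq hs h).norm
    (integrable_inv_one_add_sq.const_mul B) h

open scoped FourierTransform in
/-- A `C²` function which is integrable together with its derivatives is the Fourier transform of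
an integrable function, by Fourier inversion. -/
lemma of_decay {s s' s'' : ℝ → ℂ} {B : ℝ}
    (h : C2Bound s s' s'' B (fun z => (1 + z ^ 2)⁻¹)) (hs : ∀ z, ‖s z‖ ≤ B * (1 + z ^ 2)⁻¹) :
    FourierBound s (2 * Real.pi ^ 2 * B) := by
  have i0 := integrable_of_le_inv_one_add_sq h.continuous hs
  have i1 := integrable_of_le_inv_one_add_sq h.continuous' h.norm_le'
  have i2 := integrable_of_le_inv_one_add_sq h.continuous'' h.norm_le''
  have d1 : deriv s = s' := funext fun z => (h.hasDerivAt z).deriv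
  have d2 : deriv s' = s'' := funext fun z => (h.hasDerivAt' z).deriv
  have f1 := Real.fourier_deriv i0 (fun z => (h.hasDerivAt z).differentiableAt) (by rwa [d1])
  have f2 := Real.fourier_deriv i1 (fun z => (h.hasDerivAt' z).differentiableAt) (by rwa [d2])
  rw [d1] at f1
  rw [d2, f1] at f2
  have hcont : Continuous (𝓕 s) := by
    exact VectorFourier.fourierIntegral_continuous Real.continuous_fourierChar
      (by fun_prop) i0
  have b0 : ∀ x, ‖𝓕 s x‖ ≤ B * Real.pi := fun x =>
    (VectorFourier.norm_fourierIntegral_le_integral_norm _ _ _ _ _).trans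
      (integral_norm_le_of_le_inv_one_add_sq h.continuous hs)
  have b2 : ∀ x, (2 * Real.pi * x) ^ 2 * ‖𝓕 s x‖ ≤ B * Real.pi := fun x => by
    have e1 : ‖𝓕 s'' x‖ ≤ B * Real.pi :=
      (VectorFourier.norm_fourierIntegral_le_integral_norm _ _ _ _ _).trans
        (integral_norm_le_of_le_inv_one_add_sq h.continuous'' h.norm_le'')
    rw [f2] at e1
    refine le_trans (le_of_eq ?_) e1
    simp only [norm_smul, norm_mul, Complex.norm_ofNat, Complex.norm_real, Complex.norm_I,
      Real.norm_of_nonneg Real.pi_pos.le, Real.norm_eq_abs]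
    rw [← sq_abs, abs_mul, abs_mul, abs_of_pos Real.pi_pos, abs_two]
    ring
  have b : ∀ x, ‖𝓕 s x‖ ≤ (2 * Real.pi * B) * (1 + x ^ 2)⁻¹ := fun x => by
    have hx : (0 : ℝ) < 1 + x ^ 2 := by positivity
    rw [← div_eq_mul_inv, le_div_iff₀ hx]
    have e1 : x ^ 2 * ‖𝓕 s x‖ ≤ (2 * Real.pi * x) ^ 2 * ‖𝓕 s x‖ := by
      rw [mul_pow]
      have : (1 : ℝ) ≤ (2 * Real.pi) ^ 2 := by nlinarith [Real.pi_gt_three]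
      have hx2 := sq_nonneg x
      gcongr
      nlinarith
    linarith [b0 x, b2 x]
  have hint := integrable_of_le_inv_one_add_sq hcont b
  have hinv := h.continuous.fourierInv_fourier_eq i0 hint
  refine of_integral volume (X := fun x => 2 * Real.pi * x) (k := 𝓕 s) (by fun_prop)
    hcont.aemeasurable ?_ fun z => ?_
  · have := integral_norm_le_of_le_inv_one_add_sq hcont b
    rw [← ofReal_integral_norm_eq_lintegral_enorm hint]
    refine ENNReal.ofReal_le_ofReal (this.trans (le_of_eq (by ring)))
  · have := congrFun hinv z
    rw [Real.fourierInv_eq'] at this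
    rw [← this]
    refine integral_congr_ae (.of_forall fun x => ?_)
    simp only [osc, smul_eq_mul]
    congr 3
    simp only [RCLike.inner_apply, conj_trivial]
    push_cast
    ring

end FourierBound

/-! ### Truncation and logarithms -/

section Truncation

variable {Ω : Type*} [MeasurableSpace Ω] {μ : Measure Ω} {X : Ω → ℝ} {k : Ω → ℂ} {R : ℝ}

lemma integrable_mul_of_ae_le (hX : Measurable X) (hk : Integrable k μ)
    (hR : ∀ᵐ ω ∂μ, |X ω| ≤ R) : Integrable (fun ω => I * X ω * k ω) μ := by
  refine hk.bdd_mul (c := R) ?_ ?_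
  · exact (measurable_const.mul (measurable_ofReal.comp hX)).aestronglyMeasurable
  · filter_upwards [hR] with ω hω
    simpa using hω

lemma hasDerivAt_integral_osc (hX : Measurable X) (hk : Integrable k μ)
    (hR : ∀ᵐ ω ∂μ, |X ω| ≤ R) (z : ℝ) :
    HasDerivAt (fun z => ∫ ω, osc (X ω) z * k ω ∂μ) (∫ ω, osc (X ω) z * (I * X ω * k ω) ∂μ) z := by
  have hi := integrable_mul_of_ae_le hX hk hR
  refine (hasDerivAt_integral_of_dominated_loc_of_deriv_le (bound := fun ω => ‖I * X ω * k ω‖)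
    (F' := fun z ω => osc (X ω) z * (I * X ω * k ω)) univ_mem ?_ ?_ ?_ ?_ ?_ ?_).2
  · exact .of_forall fun z => (integrable_osc_mul hX.aemeasurable hk z).aestronglyMeasurable
  · exact integrable_osc_mul hX.aemeasurable hk z
  · exact (integrable_osc_mul hX.aemeasurable hi z).aestronglyMeasurable
  · refine .of_forall fun ω z _ => ?_
    rw [norm_mul, norm_osc, one_mul]
  · exact hi.norm
  · refine .of_forall fun ω z _ => ?_
    convert! (hasDerivAt_osc (X ω) z).mul_const (k ω) using 1
    ring

lemma continuous_integral_osc (hX : Measurable X) (hk : Integrable k μ) :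
    Continuous fun z => ∫ ω, osc (X ω) z * k ω ∂μ := by
  refine continuous_of_dominated (bound := fun ω => ‖k ω‖)
    (fun z => (integrable_osc_mul hX.aemeasurable hk z).aestronglyMeasurable) ?_ hk.norm ?_
  · simp
  · exact .of_forall fun ω => (continuous_osc_right _).mul continuous_const

lemma norm_integral_osc_le (z : ℝ) : ‖∫ ω, osc (X ω) z * k ω ∂μ‖ ≤ ∫ ω, ‖k ω‖ ∂μ := by
  refine (norm_integral_le_integral_norm _).trans (le_of_eq ?_)
  simp

/-- The Fourier transform of a compactly supported complex measure is smooth. -/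
lemma c2Bound_integral_osc (hX : Measurable X) (hk : Integrable k μ)
    (hR : ∀ᵐ ω ∂μ, |X ω| ≤ R) :
    ∃ P' P'' : ℝ → ℂ, ∃ B, 0 ≤ B ∧
      C2Bound (fun z => ∫ ω, osc (X ω) z * k ω ∂μ) P' P'' B (fun _ => 1) := by
  have h1 := integrable_mul_of_ae_le hX hk hR
  have h2 := integrable_mul_of_ae_le hX h1 hR
  refine ⟨_, _, (∫ ω, ‖I * X ω * k ω‖ ∂μ) + ∫ ω, ‖I * X ω * (I * X ω * k ω)‖ ∂μ, by positivity,
    hasDerivAt_integral_osc hX hk hR, hasDerivAt_integral_osc hX h1 hR,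
    continuous_integral_osc hX h2, fun z => ?_, fun z => ?_⟩
  · rw [mul_one]
    exact (norm_integral_osc_le z).trans (le_add_of_nonneg_right (by positivity))
  · rw [mul_one]
    exact (norm_integral_osc_le z).trans (le_add_of_nonneg_left (by positivity))

/-- Complex measures are approximated in total variation by their restrictions to compact
intervals. -/
lemma exists_truncation [SFinite μ] (hX : Measurable X) (hk : Integrable k μ) {ε : ℝ}
    (hε : 0 < ε) :
    ∃ R : ℝ, FourierBound (fun z => (∫ ω, osc (X ω) z * k ω ∂μ) -
      ∫ ω in {ω | |X ω| ≤ R}, osc (X ω) z * k ω ∂μ) ε := by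
  have hm : ∀ R : ℝ, MeasurableSet {ω | |X ω| ≤ R} := fun R =>
    measurableSet_le hX.abs measurable_const
  have ht := tendsto_setIntegral_of_antitone (μ := μ) (f := fun ω => ‖k ω‖)
    (s := fun n : ℕ => {ω | |X ω| ≤ n}ᶜ) (fun n => (hm n).compl)
    (fun m n hmn => compl_subset_compl.2 fun ω (hω : |X ω| ≤ m) =>
      show |X ω| ≤ n from hω.trans (by exact_mod_cast hmn)) ⟨0, hk.norm.integrableOn⟩
  have hempty : ⋂ n : ℕ, {ω | |X ω| ≤ (n : ℝ)}ᶜ = ∅ := by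
    rw [← compl_iUnion, compl_empty_iff, eq_univ_iff_forall]
    intro ω
    obtain ⟨n, hn⟩ := exists_nat_ge |X ω|
    exact mem_iUnion.2 ⟨n, hn⟩
  rw [hempty, setIntegral_empty] at ht
  obtain ⟨n, hn⟩ := (ht.eventually (gt_mem_nhds hε)).exists
  refine ⟨n, FourierBound.of_integral (μ.restrict {ω | |X ω| ≤ (n : ℝ)}ᶜ) hX.aemeasurable
    hk.aestronglyMeasurable.aemeasurable.restrict ?_ fun z => ?_⟩
  · rw [← ofReal_integral_norm_eq_lintegral_enorm hk.integrableOn]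
    exact ENNReal.ofReal_le_ofReal hn.le
  · rw [← integral_add_compl (hm n) (integrable_osc_mul hX.aemeasurable hk z)]
    ring

end Truncation

lemma C2Bound.mono {P P' P'' : ℝ → ℂ} {B B' : ℝ} {ρ : ℝ → ℝ} (h : C2Bound P P' P'' B ρ)
    (hB : B ≤ B') (hρ : ∀ z, 0 ≤ ρ z) : C2Bound P P' P'' B' ρ :=
  ⟨h.hasDerivAt, h.hasDerivAt', h.continuous'',
    fun z => (h.norm_le' z).trans (mul_le_mul_of_nonneg_right hB (hρ z)),
    fun z => (h.norm_le'' z).trans (mul_le_mul_of_nonneg_right hB (hρ z))⟩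

/-- The logarithm of a `C²` function which is bounded away from zero, with control of the
derivatives. -/
lemma C2Bound.exists_log_c2Bound {P P' P'' : ℝ → ℂ} {B c : ℝ} {ρ : ℝ → ℝ}
    (h : C2Bound P P' P'' B ρ) (hB : 0 ≤ B) (hc : 0 < c) (hP : ∀ z, c ≤ ‖P z‖)
    (hρ : ∀ z, 0 ≤ ρ z) (hρ1 : ∀ z, ρ z ≤ 1) :
    ∃ v v'' : ℝ → ℂ, ∃ B', 0 ≤ B' ∧ C2Bound v (fun z => P' z * (P z)⁻¹) v'' B' ρ ∧
      ∀ z, P z = Complex.exp (v z) := by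
  have hinv := h.inv hB hc hP hρ hρ1
  set D := B * c⁻¹ ^ 2 + 2 * B ^ 2 * c⁻¹ ^ 3 with hD
  have hD0 : 0 ≤ D := by positivity
  have hb : ∀ z, ‖(P z)⁻¹‖ ≤ c⁻¹ := fun z => by
    rw [norm_inv]
    exact inv_anti₀ hc (hP z)
  obtain ⟨v, hv, hPv⟩ := h.exists_log fun z => norm_pos_iff.1 (hc.trans_le (hP z))
  refine ⟨v, fun z => P'' z * (P z)⁻¹ + P' z * (-P' z * (P z)⁻¹ ^ 2), B * c⁻¹ + B * D,
    by positivity, ⟨hv, fun z => (h.hasDerivAt' z).mul (hinv.hasDerivAt z), ?_, fun z => ?_,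
    fun z => ?_⟩, hPv⟩
  · exact (h.continuous''.mul hinv.continuous).add (h.continuous'.mul hinv.continuous')
  · have h0 := hρ z
    calc ‖P' z * (P z)⁻¹‖ ≤ B * ρ z * c⁻¹ := by
          rw [norm_mul]
          gcongr
          exacts [h.norm_le' z, hb z]
      _ = B * c⁻¹ * ρ z := by ring
      _ ≤ _ := by
          gcongr
          exact le_add_of_nonneg_right (by positivity)
  · have h0 := hρ z
    calc ‖P'' z * (P z)⁻¹ + P' z * (-P' z * (P z)⁻¹ ^ 2)‖
        ≤ ‖P'' z‖ * ‖(P z)⁻¹‖ + ‖P' z‖ * ‖-P' z * (P z)⁻¹ ^ 2‖ := by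
          rw [← norm_mul, ← norm_mul]
          exact norm_add_le _ _
      _ ≤ B * ρ z * c⁻¹ + B * 1 * (D * ρ z) := by
          gcongr
          · exact h.norm_le'' z
          · exact hb z
          · exact (h.norm_le' z).trans (by gcongr; exact hρ1 z)
          · exact hinv.norm_le' z
      _ = _ := by ring

/-! ### The lattice part -/

lemma exists_pos_le_norm_of_periodic {D : ℝ → ℂ} {T : ℝ} (hT : 0 < T) (hD : Continuous D)
    (hper : Function.Periodic D T) (hne : ∀ z, D z ≠ 0) :
    ∃ δ : ℝ, 0 < δ ∧ δ ≤ 1 ∧ ∀ z, δ ≤ ‖D z‖ := by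
  obtain ⟨z₀, -, hz₀⟩ := isCompact_Icc.exists_isMinOn (nonempty_Icc.2 hT.le)
    hD.norm.continuousOn
  refine ⟨min ‖D z₀‖ 1, lt_min (norm_pos_iff.2 (hne z₀)) one_pos, min_le_right _ _, fun z => ?_⟩
  obtain ⟨y, hy, hyz⟩ := hper.exists_mem_Ico₀ hT z
  rw [hyz]
  exact (min_le_left _ _).trans (hz₀ ⟨hy.1, hy.2.le⟩)

/-- If `exp ∘ v` is periodic with a periodic logarithmic derivative, then `v` is periodic up to a
linear function. -/
lemma exists_int_of_exp_periodic {v v' : ℝ → ℂ} {T : ℝ} (hv : ∀ z, HasDerivAt v (v' z) z)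
    (hv' : Function.Periodic v' T) (hexp : Complex.exp (v T) = Complex.exp (v 0)) :
    ∃ n : ℤ, ∀ z, v (z + T) = v z + n * (2 * Real.pi * I) := by
  obtain ⟨n, hn⟩ := Complex.exp_eq_exp_iff_exists_int.1 hexp
  have hd : ∀ z, HasDerivAt (fun z => v (z + T) - v z) 0 z := fun z => by
    have h1 := (HasDerivAt.comp_add_const z T (hv (z + T))).sub (hv z)
    rw [hv' z, sub_self] at h1
    exact h1
  refine ⟨n, fun z => ?_⟩
  have := is_const_of_deriv_eq_zero (fun z => (hd z).differentiableAt) (fun z => (hd z).deriv) z 0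
  simp only [zero_add] at this
  rw [← sub_eq_iff_eq_add', this, hn]
  ring

lemma periodic_deriv {P P' : ℝ → ℂ} {T : ℝ} (h : ∀ z, HasDerivAt P (P' z) z)
    (hper : Function.Periodic P T) : Function.Periodic P' T := fun z => by
  have h1 := HasDerivAt.comp_add_const z T (h (z + T))
  rw [show (fun z => P (z + T)) = P from funext hper] at h1
  exact h1.unique (h z)

/-- A zero-free periodic function which is close to a periodic `C²` function `P` with respect to
the total variation of its Fourier transform is, up to a character, the exponential of the
Fourier transform of a complex measure. -/
lemma exists_log_of_periodic {D P P' P'' : ℝ → ℂ} {T δ B : ℝ} (hT : 0 < T) (hδ : 0 < δ)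
    (hδ1 : δ ≤ 1) (hD : ∀ z, δ ≤ ‖D z‖) (hE : FourierBound (fun z => D z - P z) (δ / 3))
    (hB : 0 ≤ B) (hP : C2Bound P P' P'' B fun _ => 1) (hPper : Function.Periodic P T) :
    ∃ n : ℤ, ∃ w C, 0 ≤ C ∧ FourierBound w C ∧
      ∀ z, D z = osc (n * (2 * Real.pi / T)) z * Complex.exp (w z) := by
  -- `|P| ≥ c`, and the approximation error `δ / 3` is half of `c`: the logarithmic series has ratio
  -- `1 / 2`.
  set c := 2 * δ / 3 with hc
  have hc0 : 0 < c := by positivity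
  have hPc : ∀ z, c ≤ ‖P z‖ := fun z => by
    have h1 := hE.norm_le (by positivity) z
    have h2 := norm_sub_norm_le (D z) (P z)
    have h3 := hD z
    linarith
  have hPne : ∀ z, P z ≠ 0 := fun z => norm_pos_iff.1 (hc0.trans_le (hPc z))
  have hinvc : ∀ z, ‖(P z)⁻¹‖ ≤ c⁻¹ := fun z => by
    rw [norm_inv]
    exact inv_anti₀ hc0 (hPc z)
  have hc1 : 1 ≤ c⁻¹ := (one_le_inv₀ hc0).2 (by linarith)
  obtain ⟨K, hK, hKper⟩ := FourierBound.exists_of_periodic hT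
  have hρ : ∀ z : ℝ, (0 : ℝ) ≤ (fun _ => 1) z := fun _ => zero_le_one
  have hρ1 : ∀ z : ℝ, (fun _ => (1 : ℝ)) z ≤ 1 := fun _ => le_rfl
  have hinv := hP.inv hB hc0 hPc hρ hρ1
  set D' := B * c⁻¹ ^ 2 + 2 * B ^ 2 * c⁻¹ ^ 3 with hD'
  have hD'0 : 0 ≤ D' := by positivity
  have hpows : ∀ n : ℕ, FourierBound (fun z => (P z)⁻¹ ^ n)
      (K * (1 + (D' + D' ^ 2)) * ((n + 1) ^ 2 * c⁻¹ ^ n)) := fun n => by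
    rw [mul_assoc]
    have hn : (1 : ℝ) ≤ (n + 1) ^ 2 := one_le_pow₀ (by simp)
    refine hKper _ _ _ _ (by positivity) (fun z => by simp only [hPper z])
      ((hinv.pow hD'0 hc1 hinvc hρ hρ1 n).mono
        (mul_le_mul_of_nonneg_right (by linarith) (by positivity)) hρ) fun z => ?_
    rw [norm_pow]
    calc ‖(P z)⁻¹‖ ^ n ≤ 1 * (1 * c⁻¹ ^ n) := by
          rw [one_mul, one_mul]
          gcongr
          exact hinvc z
      _ ≤ _ := by
          gcongr
          have : 0 ≤ D' + D' ^ 2 := by positivity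
          linarith
  obtain ⟨w, C, hC, hw, hDw⟩ := FourierBound.exists_log_div (M := c⁻¹) hPne (by positivity)
    (by positivity) (by positivity) hinvc hE hpows (by rw [hc]; field_simp; norm_num)
  obtain ⟨v, v'', B', hB', hv, hPv⟩ := hP.exists_log_c2Bound hB hc0 hPc hρ hρ1
  have hP'per := periodic_deriv hP.hasDerivAt hPper
  obtain ⟨n, hn⟩ := exists_int_of_exp_periodic (T := T) hv.hasDerivAt
    (fun z => by simp only [hPper z, hP'per z]) (by
      rw [← hPv, ← hPv]
      simpa using hPper 0)
  set κ : ℂ := ((n * (2 * Real.pi / T) : ℝ) : ℂ) * I with hκ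
  -- The winding number `n` is removed by the linear function `κ z`.
  have hu : C2Bound (fun z => v z - κ * z) (fun z => P' z * (P z)⁻¹ - κ)
      v'' (B' + ‖κ‖) (fun _ => 1) := by
    refine ⟨fun z => ?_, fun z => (hv.hasDerivAt' z).sub_const _, hv.continuous'', fun z => ?_,
      fun z => ?_⟩
    · have := (hv.hasDerivAt z).sub ((hasDerivAt_id z).ofReal_comp.const_mul κ)
      simpa using! this
    · rw [mul_one]
      exact (norm_sub_le _ _).trans (by gcongr; simpa using hv.norm_le' z)
    · rw [mul_one]
      exact (hv.norm_le'' z).trans (by rw [mul_one]; exact le_add_of_nonneg_right (norm_nonneg _))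
  have huper : Function.Periodic (fun z => v z - κ * (z : ℝ)) T := fun z => by
    beta_reduce
    rw [hn, hκ]
    have : (T : ℂ) ≠ 0 := by exact_mod_cast hT.ne'
    push_cast
    field_simp
    ring
  obtain ⟨B₀, hB₀⟩ : ∃ B₀ : ℝ, ∀ z, ‖v z - κ * (z : ℝ)‖ ≤ B₀ := by
    obtain ⟨B₀, hB₀⟩ := isCompact_Icc.exists_bound_of_continuousOn (s := Icc 0 T)
      hu.continuous.continuousOn
    refine ⟨B₀, fun z => ?_⟩
    obtain ⟨y, hy, hyz⟩ := huper.exists_mem_Ico₀ hT z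
    rw [hyz]
    exact hB₀ y ⟨hy.1, hy.2.le⟩
  have hB₀0 : 0 ≤ B₀ := (norm_nonneg _).trans (hB₀ 0)
  have hufb := hKper _ _ _ (B' + ‖κ‖ + B₀) (by positivity) huper
    (hu.mono (le_add_of_nonneg_right hB₀0) hρ)
    (fun z => (hB₀ z).trans (le_add_of_nonneg_left (by positivity)))
  refine ⟨n, _, _, ?_, hw.add hufb hC (by positivity), fun z => ?_⟩
  · positivity
  · rw [hDw, hPv, Complex.exp_add, Complex.exp_sub, osc]
    have : ((n * (2 * Real.pi / T) * z : ℝ) : ℂ) * I = κ * z := by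
      rw [hκ]
      push_cast
      ring
    rw [this]
    field_simp

/-- The Wiener–Lévy theorem for the lattice part: a zero-free Fourier transform of a finite
measure on a lattice is, up to a character, the exponential of the Fourier transform of a complex
measure. -/
theorem exists_log_charFun_lattice (μ : Measure ℝ) [IsFiniteMeasure μ] {r h : ℝ} (hh : 0 < h)
    (hsupp : μ (lattice r h)ᶜ = 0) (hne : ∀ z, charFun μ z ≠ 0) :
    ∃ b : ℝ, ∃ w C, 0 ≤ C ∧ FourierBound w C ∧
      ∀ z, charFun μ z = osc b z * Complex.exp (w z) := by
  set T := 2 * Real.pi / h with hTdef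
  have hT : 0 < T := by positivity
  have hX : Measurable fun x : ℝ => x - r := by fun_prop
  have hk : Integrable (fun _ : ℝ => (1 : ℂ)) μ := integrable_const _
  set D : ℝ → ℂ := fun z => ∫ x, osc (x - r) z * 1 ∂μ with hDdef
  have hDchar : ∀ z, charFun μ z = osc r z * D z := fun z => by
    rw [charFun_apply_real, hDdef, ← integral_const_mul]
    refine integral_congr_ae (.of_forall fun x => ?_)
    simp only [mul_one]
    rw [← osc_add_left, osc]
    congr 1
    push_cast
    ring
  have hDne : ∀ z, D z ≠ 0 := fun z h0 => hne z (by rw [hDchar, h0, mul_zero])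
  have hlat : ∀ᵐ x ∂μ, x ∈ lattice r h := hsupp
  have hosc : ∀ᵐ x ∂μ, ∀ z, osc (x - r) (z + T) = osc (x - r) z := by
    filter_upwards [hlat]
    rintro x ⟨n, rfl⟩ z
    rw [osc_add_right, osc, osc]
    have : (((r + h * n - r) * T : ℝ) : ℂ) * I = n * (2 * Real.pi * I) := by
      have : (r + h * n - r) * T = n * (2 * Real.pi) := by
        rw [hTdef]
        field_simp
        ring
      rw [this]
      push_cast
      ring
    rw [this, Complex.exp_int_mul_two_pi_mul_I, mul_one]
  have hDper : Function.Periodic D T := fun z => by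
    refine integral_congr_ae ?_
    filter_upwards [hosc] with x hx
    rw [hx]
  obtain ⟨δ, hδ, hδ1, hδD⟩ :=
    exists_pos_le_norm_of_periodic hT (continuous_integral_osc hX hk) hDper hDne
  obtain ⟨R, hR⟩ := exists_truncation hX hk (ε := δ / 3) (by positivity)
  obtain ⟨P', P'', B, hB, hP⟩ := c2Bound_integral_osc (R := R) hX hk.integrableOn
    (μ := μ.restrict {x | |x - r| ≤ R}) (ae_restrict_mem (measurableSet_le hX.abs measurable_const))
  obtain ⟨n, w, C, hC, hw, hDw⟩ := exists_log_of_periodic hT hδ hδ1 hδD hR hB hP fun z => by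
    refine integral_congr_ae ?_
    filter_upwards [ae_restrict_of_ae hosc] with x hx
    rw [hx]
  exact ⟨r + n * (2 * Real.pi / T), w, C, hC, hw, fun z => by
    rw [hDchar, osc_add_left, mul_assoc, ← hDw]⟩

/-! ### Smooth approximation of the absolutely continuous part -/

open scoped FourierTransform in
lemma integral_osc_mul_eq_fourier (f : ℝ → ℂ) (z : ℝ) :
    ∫ x, osc x z * f x = 𝓕 f (-(2 * Real.pi)⁻¹ * z) := by
  rw [Real.fourier_eq']
  refine integral_congr_ae (.of_forall fun x => ?_)
  simp only [osc, smul_eq_mul, RCLike.inner_apply, conj_trivial]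
  congr 3
  have := Real.pi_pos.ne'
  field_simp

lemma tendsto_integral_osc_mul_cocompact (f : ℝ → ℂ) :
    Tendsto (fun z => ∫ x, osc x z * f x) (cocompact ℝ) (𝓝 0) := by
  simp only [integral_osc_mul_eq_fourier]
  have h : -(2 * Real.pi)⁻¹ ≠ 0 := by simp [Real.pi_pos.ne']
  exact (Real.zero_at_infty_fourier f).comp (tendsto_cocompact_mul_left₀ h)

lemma _root_.SchwartzMap.exists_norm_le_inv_one_add_sq_sq (q : SchwartzMap ℝ ℂ) {a : ℝ}
    (ha : a ≠ 0) : ∃ C, 0 ≤ C ∧ ∀ z, ‖q (a * z)‖ ≤ C * ((1 + z ^ 2)⁻¹) ^ 2 := by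
  obtain ⟨C₀, hC₀, h0⟩ := q.decay 0 0
  obtain ⟨C₄, hC₄, h4⟩ := q.decay 4 0
  refine ⟨2 * (C₀ + C₄ / a ^ 4), by positivity, fun z => ?_⟩
  have h0 := h0 (a * z)
  have h4 := h4 (a * z)
  rw [norm_iteratedFDeriv_zero] at h0 h4
  rw [pow_zero, one_mul] at h0
  rw [Real.norm_eq_abs, Even.pow_abs (by decide), mul_pow] at h4
  have ha4 : 0 < a ^ 4 := by positivity
  rw [inv_pow, ← div_eq_mul_inv, le_div_iff₀ (by positivity)]
  have h4' : z ^ 4 * ‖q (a * z)‖ ≤ C₄ / a ^ 4 := by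
    rw [le_div_iff₀ ha4]
    linarith
  have : (1 + z ^ 2) ^ 2 ≤ 2 * (1 + z ^ 4) := by nlinarith [sq_nonneg (z ^ 2 - 1)]
  calc ‖q (a * z)‖ * (1 + z ^ 2) ^ 2 ≤ ‖q (a * z)‖ * (2 * (1 + z ^ 4)) := by gcongr
    _ = 2 * (‖q (a * z)‖ + z ^ 4 * ‖q (a * z)‖) := by ring
    _ ≤ _ := by gcongr

open scoped FourierTransform in
/-- The Fourier transform of a Schwartz function and its derivatives decay rapidly. -/
lemma c2Bound_schwartz (p : SchwartzMap ℝ ℂ) :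
    ∃ s' s'' : ℝ → ℂ, ∃ B, 0 ≤ B ∧
      C2Bound (fun z => ∫ x, osc x z * p x) s' s'' B (fun z => ((1 + z ^ 2)⁻¹) ^ 2) ∧
      ∀ z, ‖∫ x, osc x z * p x‖ ≤ B * ((1 + z ^ 2)⁻¹) ^ 2 := by
  set a : ℝ := -(2 * Real.pi)⁻¹ with ha
  have ha0 : a ≠ 0 := by simp [ha, Real.pi_pos.ne']
  set q : SchwartzMap ℝ ℂ := 𝓕 p with hq
  set q1 := SchwartzMap.derivCLM ℂ ℂ q
  set q2 := SchwartzMap.derivCLM ℂ ℂ q1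
  have hp : (fun z => ∫ x, osc x z * p x) = fun z => q (a * z) := funext fun z => by
    rw [integral_osc_mul_eq_fourier, hq, SchwartzMap.fourier_coe]
  obtain ⟨C₀, hC₀, h0⟩ := q.exists_norm_le_inv_one_add_sq_sq ha0
  obtain ⟨C₁, hC₁, h1⟩ := q1.exists_norm_le_inv_one_add_sq_sq ha0
  obtain ⟨C₂, hC₂, h2⟩ := q2.exists_norm_le_inv_one_add_sq_sq ha0
  have hder : ∀ g : SchwartzMap ℝ ℂ, ∀ z, HasDerivAt (fun z => g (a * z))
      (a * SchwartzMap.derivCLM ℂ ℂ g (a * z)) z := fun g z => by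
    have h1 : HasDerivAt (fun z : ℝ => a * z) a z := by
      simpa using (hasDerivAt_id z).const_mul a
    have := (g.hasDerivAt (a * z)).scomp z h1
    rw [Complex.real_smul] at this
    exact this
  refine ⟨fun z => a * q1 (a * z), fun z => a * (a * q2 (a * z)),
    C₀ + |a| * C₁ + |a| * |a| * C₂, by positivity, ?_, ?_⟩
  · rw [hp]
    refine ⟨hder q, fun z => (hder q1 z).const_mul _, ?_, fun z => ?_, fun z => ?_⟩
    · have := q2.continuous
      fun_prop
    · have hz : (0 : ℝ) ≤ ((1 + z ^ 2)⁻¹) ^ 2 := by positivity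
      have := mul_le_mul_of_nonneg_left (h1 z) (abs_nonneg a)
      rw [norm_mul, Complex.norm_real, Real.norm_eq_abs]
      refine this.trans ?_
      rw [← mul_assoc]
      gcongr
      nlinarith [mul_nonneg (mul_self_nonneg |a|) hC₂]
    · have hz : (0 : ℝ) ≤ ((1 + z ^ 2)⁻¹) ^ 2 := by positivity
      have := mul_le_mul_of_nonneg_left (h2 z) (mul_self_nonneg |a|)
      rw [norm_mul, norm_mul, Complex.norm_real, Real.norm_eq_abs, ← mul_assoc]
      refine this.trans ?_
      rw [← mul_assoc]
      gcongr
      nlinarith [mul_nonneg (abs_nonneg a) hC₁]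
  · intro z
    rw [congrFun hp z]
    refine (h0 z).trans ?_
    gcongr
    rw [add_assoc]
    exact le_add_of_nonneg_right (by positivity)

lemma C2Bound.mul {P P' P'' Q Q' Q'' : ℝ → ℂ} {B D : ℝ} {ρ : ℝ → ℝ} (h : C2Bound P P' P'' B ρ)
    (hP : ∀ z, ‖P z‖ ≤ B * ρ z) (h' : C2Bound Q Q' Q'' D fun _ => 1) (hQ : ∀ z, ‖Q z‖ ≤ D)
    (hB : 0 ≤ B) (hρ : ∀ z, 0 ≤ ρ z) (hD : 0 ≤ D) :
    C2Bound (fun z => P z * Q z) (fun z => P' z * Q z + P z * Q' z)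
      (fun z => P'' z * Q z + P' z * Q' z + (P' z * Q' z + P z * Q'' z)) (4 * (B * D)) ρ := by
  have key : ∀ z, ∀ x y : ℂ, ‖x‖ ≤ B * ρ z → ‖y‖ ≤ D → ‖x * y‖ ≤ B * D * ρ z :=
    fun z x y hx hy => by
      have := hρ z
      rw [norm_mul, mul_right_comm]
      gcongr
  have h1 : ∀ z, ‖Q' z‖ ≤ D := fun z => by simpa using h'.norm_le' z
  have h2 : ∀ z, ‖Q'' z‖ ≤ D := fun z => by simpa using h'.norm_le'' z
  refine ⟨fun z => (h.hasDerivAt z).mul (h'.hasDerivAt z), fun z =>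
    ((h.hasDerivAt' z).mul (h'.hasDerivAt z)).add ((h.hasDerivAt z).mul (h'.hasDerivAt' z)),
    ?_, fun z => ?_, fun z => ?_⟩
  · have := h.continuous
    have := h.continuous'
    have := h.continuous''
    have := h'.continuous
    have := h'.continuous'
    have := h'.continuous''
    fun_prop
  · have e1 := key z _ _ (h.norm_le' z) (hQ z)
    have e2 := key z _ _ (hP z) (h1 z)
    have e3 : 0 ≤ B * D * ρ z := mul_nonneg (by positivity) (hρ z)
    refine (norm_add_le _ _).trans ?_
    linarith
  · have e1 := key z _ _ (h.norm_le'' z) (hQ z)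
    have e2 := key z _ _ (h.norm_le' z) (h1 z)
    have e3 := key z _ _ (hP z) (h2 z)
    refine (norm_add_le _ _).trans ?_
    have := norm_add_le (P'' z * Q z) (P' z * Q' z)
    have := norm_add_le (P' z * Q' z) (P z * Q'' z)
    linarith

/-- The product of the Fourier transform of an integrable function and that of a complex measure
is approximated by `C²` functions of rapid decay. -/
lemma exists_c2_approx {f : ℝ → ℂ} (hf : Integrable f) {ψ : ℝ → ℂ} {C : ℝ} (hC : 0 ≤ C)
    (hψ : FourierBound ψ C) {ε : ℝ} (hε : 0 < ε) :
    ∃ s s' s'' : ℝ → ℂ, ∃ B, 0 ≤ B ∧ C2Bound s s' s'' B (fun z => ((1 + z ^ 2)⁻¹) ^ 2) ∧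
      (∀ z, ‖s z‖ ≤ B * ((1 + z ^ 2)⁻¹) ^ 2) ∧
      FourierBound (fun z => (∫ x, osc x z * f x) * ψ z - s z) ε := by
  set ε₁ := ε / (2 * (C + 1)) with hε₁
  obtain ⟨g, hg₁, hg₂, hg₃⟩ := MemLp.exist_eLpNorm_sub_le ENNReal.one_ne_top le_rfl
    (memLp_one_iff_integrable.2 hf) (ε := ε₁) (by positivity)
  set p : SchwartzMap ℝ ℂ := hg₁.toSchwartzMap hg₂ with hp
  have hpg : ∀ x, p x = g x := fun x => by simp [hp]
  obtain ⟨t', t'', B, hB, ht, htB⟩ := c2Bound_schwartz p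
  have h1 : FourierBound (fun z => (∫ x, osc x z * f x) - ∫ x, osc x z * p x) ε₁ := by
    refine FourierBound.of_integral volume (X := id) (k := fun x => f x - p x) aemeasurable_id
      (hf.sub p.integrable).aestronglyMeasurable.aemeasurable ?_ fun z => ?_
    · rw [eLpNorm_one_eq_lintegral_enorm] at hg₃
      simpa only [Pi.sub_apply, hpg] using hg₃
    · rw [← integral_sub (integrable_osc_mul (X := fun x => x) aemeasurable_id hf z)
        (integrable_osc_mul (X := fun x => x) aemeasurable_id p.integrable z)]
      simp only [mul_sub, id]
  set A := ∫ x, ‖p x‖ with hA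
  have hA0 : 0 ≤ A := by positivity
  have h2 : FourierBound (fun z => ∫ x, osc x z * p x) A := by
    refine FourierBound.of_integral volume (X := fun x => x) (k := p) aemeasurable_id
      p.integrable.aestronglyMeasurable.aemeasurable ?_ fun z => rfl
    rw [hA, ofReal_integral_norm_eq_lintegral_enorm p.integrable]
  set ε₂ := ε / (2 * (A + 1)) with hε₂
  obtain ⟨m, hm1, hm2, hm3⟩ := id hψ
  have hk := integrable_snd_of_lintegral hm2
  obtain ⟨R, hR⟩ := exists_truncation measurable_fst hk (ε := ε₂) (by positivity)
  obtain ⟨Q', Q'', D, hD, hQ⟩ := c2Bound_integral_osc (R := R) measurable_fst hk.integrableOn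
    (μ := m.restrict {p | |p.1| ≤ R})
    (ae_restrict_mem (measurableSet_le measurable_fst.abs measurable_const))
  set Q : ℝ → ℂ := fun z => ∫ p in {p : ℝ × ℂ | |p.1| ≤ R}, osc p.1 z * p.2 ∂m with hQdef
  set E : ℝ := ∫ p in {p : ℝ × ℂ | |p.1| ≤ R}, ‖p.2‖ ∂m with hE
  have hE0 : 0 ≤ E := by positivity
  have hQb : ∀ z, ‖Q z‖ ≤ E := norm_integral_osc_le
  refine ⟨_, _, _, 4 * (B * (D + E)), by positivity,
    ht.mul htB (hQ.mono (le_add_of_nonneg_right hE0) fun _ => zero_le_one)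
    (fun z => (hQb z).trans (le_add_of_nonneg_left hD)) hB (fun z => by positivity)
    (by positivity), fun z => ?_, ?_⟩
  · rw [norm_mul]
    calc _ ≤ (B * ((1 + z ^ 2)⁻¹) ^ 2) * (D + E) := by
          gcongr
          · exact htB z
          · exact (hQb z).trans (le_add_of_nonneg_left hD)
      _ = 1 * (B * (D + E)) * ((1 + z ^ 2)⁻¹) ^ 2 := by ring
      _ ≤ 4 * (B * (D + E)) * ((1 + z ^ 2)⁻¹) ^ 2 := by
          rw [mul_assoc 4, mul_assoc 1]
          gcongr
          norm_num
  · have h3 := (h1.mul hψ (by positivity)).add (h2.mul hR hA0) (by positivity) (by positivity)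
    refine (h3.mono ?_).congr fun z => ?_
    · have e1 : ε₁ * C ≤ ε / 2 := by
        rw [hε₁, div_mul_eq_mul_div, div_le_iff₀ (by positivity)]
        nlinarith
      have e2 : A * ε₂ ≤ ε / 2 := by
        rw [hε₂, mul_div_assoc', div_le_iff₀ (by positivity)]
        nlinarith
      linarith
    · rw [← hm3]
      ring

/-! ### A model function with winding number one -/

/-- The Gaussian density, scaled to have total mass `2π`. -/
def gaussRate (z : ℝ) : ℝ := √(2 * Real.pi) * Real.exp (-(1 / 2) * z ^ 2)

/-- The primitive of `gaussRate`, which increases from `-π` to `π`. The function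
`z ↦ exp (i * gaussAngle z)` has winding number one. -/
def gaussAngle (z : ℝ) : ℝ := ∫ t in (0 : ℝ)..z, gaussRate t

lemma continuous_gaussRate : Continuous gaussRate := by
  unfold gaussRate
  fun_prop

lemma hasDerivAt_gaussAngle (z : ℝ) : HasDerivAt gaussAngle (gaussRate z) z :=
  intervalIntegral.integral_hasDerivAt_right (continuous_gaussRate.intervalIntegrable _ _)
    (continuous_gaussRate.stronglyMeasurableAtFilter _ _) continuous_gaussRate.continuousAt

lemma hasDerivAt_gaussRate (z : ℝ) : HasDerivAt gaussRate (-z * gaussRate z) z := by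
  have h : HasDerivAt (fun z : ℝ => -(1 / 2) * z ^ 2) (-z) z := by
    convert! ((hasDerivAt_id z).pow 2).const_mul (-(1 / 2 : ℝ)) using 1
    simp
  convert! h.exp.const_mul (√(2 * Real.pi)) using 1
  rw [gaussRate]
  ring

lemma gaussAngle_neg (z : ℝ) : gaussAngle (-z) = -gaussAngle z := by
  have := intervalIntegral.integral_comp_neg (a := 0) (b := z) gaussRate
  rw [neg_zero] at this
  rw [gaussAngle, ← neg_eq_iff_eq_neg, ← intervalIntegral.integral_symm, ← this, gaussAngle]
  refine intervalIntegral.integral_congr fun x _ => ?_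
  simp [gaussRate]

lemma tendsto_gaussAngle_atTop : Tendsto gaussAngle atTop (𝓝 Real.pi) := by
  have hi : Integrable gaussRate := (integrable_exp_neg_mul_sq (by norm_num)).const_mul _
  have h := intervalIntegral_tendsto_integral_Ioi 0 hi.integrableOn tendsto_id
  have he : ∫ x in Ioi (0 : ℝ), gaussRate x = Real.pi := by
    simp only [gaussRate]
    rw [integral_const_mul, integral_gaussian_Ioi, div_div_eq_mul_div, div_one,
      mul_comm Real.pi 2, mul_div_assoc', Real.mul_self_sqrt (by positivity)]
    ring
  rw [he] at h
  exact h

lemma tendsto_gaussAngle_atBot : Tendsto gaussAngle atBot (𝓝 (-Real.pi)) := by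
  have := (tendsto_gaussAngle_atTop.comp tendsto_neg_atBot_atTop).neg
  refine this.congr fun z => ?_
  simp [gaussAngle_neg]

lemma one_add_sq_mul_gaussRate_le (z : ℝ) :
    (1 + |z|) * gaussRate z ≤ 2 * (√(2 * Real.pi) * 216) * ((1 + z ^ 2)⁻¹) ^ 2 := by
  have h1 : (1 + z ^ 2) ^ 3 * Real.exp (-(1 / 2) * z ^ 2) ≤ 216 := by
    -- The constant is `6 ^ 3`, from `1 + z ^ 2 ≤ 6 * exp (z ^ 2 / 6)`.
    have h2 : ((1 + z ^ 2) / 6) ^ 3 ≤ Real.exp (z ^ 2 / 6) ^ 3 := by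
      gcongr
      have := Real.add_one_le_exp (z ^ 2 / 6)
      linarith
    rw [← Real.exp_nat_mul] at h2
    have h3 : Real.exp (-(1 / 2) * z ^ 2) = (Real.exp ((3 : ℕ) * (z ^ 2 / 6)))⁻¹ := by
      rw [← Real.exp_neg]
      congr 1
      push_cast
      ring
    rw [h3, ← div_eq_mul_inv, div_le_iff₀ (Real.exp_pos _)]
    rw [div_pow] at h2
    linarith
  have h4 : 1 + |z| ≤ 2 * (1 + z ^ 2) := by
    nlinarith [sq_abs z, abs_nonneg z, sq_nonneg (|z| - 1)]
  rw [inv_pow, ← div_eq_mul_inv, le_div_iff₀ (by positivity), gaussRate]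
  have hs := Real.sqrt_nonneg (2 * Real.pi)
  calc (1 + |z|) * (√(2 * Real.pi) * Real.exp (-(1 / 2) * z ^ 2)) * (1 + z ^ 2) ^ 2
      ≤ (2 * (1 + z ^ 2)) * (√(2 * Real.pi) * Real.exp (-(1 / 2) * z ^ 2)) * (1 + z ^ 2) ^ 2 := by
        gcongr
    _ = 2 * (√(2 * Real.pi) * ((1 + z ^ 2) ^ 3 * Real.exp (-(1 / 2) * z ^ 2))) := by ring
    _ ≤ 2 * (√(2 * Real.pi) * 216) := by gcongr

lemma gaussRate_nonneg (z : ℝ) : 0 ≤ gaussRate z := by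
  unfold gaussRate
  positivity

/-! ### Logarithms on the line -/

lemma inv_one_add_sq_le_one (z : ℝ) : (1 + z ^ 2)⁻¹ ≤ 1 :=
  inv_le_one_of_one_le₀ (by nlinarith [sq_nonneg z])

lemma inv_one_add_sq_sq_le (z : ℝ) : ((1 + z ^ 2)⁻¹) ^ 2 ≤ (1 + z ^ 2)⁻¹ := by
  rw [sq]
  exact mul_le_of_le_one_left (by positivity) (inv_one_add_sq_le_one z)

lemma norm_le_of_deriv_decay_of_nonneg {u u' : ℝ → ℂ} {B : ℝ} (hB : 0 ≤ B)
    (hu : ∀ z, HasDerivAt u (u' z) z) (hc : Continuous u')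
    (hb : ∀ z, ‖u' z‖ ≤ B * ((1 + z ^ 2)⁻¹) ^ 2) (ht : Tendsto u atTop (𝓝 0)) {z : ℝ}
    (hz : 0 ≤ z) : ‖u z‖ ≤ B * Real.pi * (1 + z ^ 2)⁻¹ := by
  have hi : Integrable u' := FourierBound.integrable_of_le_inv_one_add_sq hc fun z =>
    (hb z).trans (mul_le_mul_of_nonneg_left (inv_one_add_sq_sq_le z) hB)
  have h := integral_Ioi_of_hasDerivAt_of_tendsto' (fun x (_ : x ∈ Ici z) => hu x)
    hi.integrableOn ht
  rw [zero_sub] at h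
  rw [← norm_neg, ← h]
  have hint : Integrable (fun t : ℝ => B * (1 + z ^ 2)⁻¹ * (1 + t ^ 2)⁻¹) :=
    integrable_inv_one_add_sq.const_mul _
  calc ‖∫ x in Ioi z, u' x‖ ≤ ∫ x in Ioi z, ‖u' x‖ := norm_integral_le_integral_norm _
    _ ≤ ∫ t in Ioi z, B * (1 + z ^ 2)⁻¹ * (1 + t ^ 2)⁻¹ := by
        refine setIntegral_mono_on hi.norm.integrableOn hint.integrableOn measurableSet_Ioi
          fun t ht => (hb t).trans ?_
        rw [sq, ← mul_assoc]
        have : z ≤ t := le_of_lt ht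
        gcongr
    _ ≤ ∫ t, B * (1 + z ^ 2)⁻¹ * (1 + t ^ 2)⁻¹ :=
        setIntegral_le_integral hint (.of_forall fun t => by positivity)
    _ = B * Real.pi * (1 + z ^ 2)⁻¹ := by
        rw [integral_const_mul, integral_univ_inv_one_add_sq]
        ring

lemma norm_le_of_deriv_decay {u u' : ℝ → ℂ} {B : ℝ} (hB : 0 ≤ B)
    (hu : ∀ z, HasDerivAt u (u' z) z) (hc : Continuous u')
    (hb : ∀ z, ‖u' z‖ ≤ B * ((1 + z ^ 2)⁻¹) ^ 2) (ht : Tendsto u atTop (𝓝 0))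
    (ht' : Tendsto u atBot (𝓝 0)) (z : ℝ) : ‖u z‖ ≤ B * Real.pi * (1 + z ^ 2)⁻¹ := by
  rcases le_total 0 z with hz | hz
  · exact norm_le_of_deriv_decay_of_nonneg hB hu hc hb ht hz
  · have := norm_le_of_deriv_decay_of_nonneg (u := fun z => u (-z)) (u' := fun z => -u' (-z)) hB
      (fun z => by
        have := (hu (-z)).scomp z (hasDerivAt_neg z)
        simpa using! this)
      (by fun_prop) (fun z => by simpa using hb (-z)) (ht'.comp tendsto_neg_atTop_atBot)
      (neg_nonneg.2 hz)
    simpa using this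

/-- A smooth zero-free function tending to `1` at both ends is, up to a power of
`exp (i * gaussAngle)` which removes its winding, the exponential of the Fourier transform of a
complex measure. -/
lemma exists_log_of_c2_decay {P P' P'' : ℝ → ℂ} {B c : ℝ} (hB : 0 ≤ B)
    (hP : C2Bound P P' P'' B fun z => ((1 + z ^ 2)⁻¹) ^ 2) (hc : 0 < c) (hPc : ∀ z, c ≤ ‖P z‖)
    (htop : Tendsto P atTop (𝓝 1)) (hbot : Tendsto P atBot (𝓝 1)) :
    ∃ n : ℤ, ∃ w C, 0 ≤ C ∧ FourierBound w C ∧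
      ∀ z, P z = Complex.exp (w z + n * gaussAngle z * I) := by
  have hρ : ∀ z : ℝ, (0 : ℝ) ≤ ((1 + z ^ 2)⁻¹) ^ 2 := fun z => by positivity
  have hρ1 : ∀ z : ℝ, ((1 + z ^ 2)⁻¹) ^ 2 ≤ 1 := fun z =>
    (inv_one_add_sq_sq_le z).trans (inv_one_add_sq_le_one z)
  obtain ⟨v, v'', B', hB', hv, hPv⟩ := hP.exists_log_c2Bound hB hc hPc hρ hρ1
  have hi := FourierBound.integrable_of_le_inv_one_add_sq hv.continuous' fun z =>
    (hv.norm_le' z).trans (mul_le_mul_of_nonneg_left (inv_one_add_sq_sq_le z) hB')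
  have ht := tendsto_limUnder_of_hasDerivAt_of_integrableOn_Ioi (a := 0)
    (fun x _ => hv.hasDerivAt x) hi.integrableOn
  have hb := tendsto_limUnder_of_hasDerivAt_of_integrableOn_Iic (a := 0)
    (fun x _ => hv.hasDerivAt x) hi.integrableOn
  set L := limUnder atTop v
  set L' := limUnder atBot v
  have hL : Complex.exp L = Complex.exp L' := by
    have h1 : Tendsto P atTop (𝓝 (Complex.exp L)) := by
      rw [show P = fun z => Complex.exp (v z) from funext hPv]
      exact (Complex.continuous_exp.tendsto L).comp ht
    have h2 : Tendsto P atBot (𝓝 (Complex.exp L')) := by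
      rw [show P = fun z => Complex.exp (v z) from funext hPv]
      exact (Complex.continuous_exp.tendsto L').comp hb
    rw [tendsto_nhds_unique h1 htop, tendsto_nhds_unique h2 hbot]
  obtain ⟨n, hn⟩ := Complex.exp_eq_exp_iff_exists_int.1 hL
  -- The limits of `v` at the two ends differ by `2πin`, as `gaussAngle` runs from `-π` to `π`;
  -- hence `u` vanishes at both ends.
  set u : ℝ → ℂ := fun z => v z - (L' + n * ((gaussAngle z + Real.pi : ℝ) : ℂ) * I) with hu
  set G := 2 * (√(2 * Real.pi) * 216) with hG
  have hG0 : 0 ≤ G := by positivity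
  have hg1 : ∀ z, gaussRate z ≤ G * ((1 + z ^ 2)⁻¹) ^ 2 := fun z => by
    refine le_trans ?_ (one_add_sq_mul_gaussRate_le z)
    exact le_mul_of_one_le_left (gaussRate_nonneg z) (by simp)
  have hg2 : ∀ z, |z| * gaussRate z ≤ G * ((1 + z ^ 2)⁻¹) ^ 2 := fun z => by
    refine le_trans ?_ (one_add_sq_mul_gaussRate_le z)
    have := gaussRate_nonneg z
    gcongr
    linarith
  have huC : C2Bound u (fun z => P' z * (P z)⁻¹ - n * (gaussRate z : ℂ) * I)
      (fun z => v'' z - n * ((-z * gaussRate z : ℝ) : ℂ) * I) (B' + ‖(n : ℂ)‖ * G)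
      (fun z => ((1 + z ^ 2)⁻¹) ^ 2) := by
    refine ⟨fun z => ?_, fun z => ?_, ?_, fun z => ?_, fun z => ?_⟩
    · exact (hv.hasDerivAt z).sub (((((hasDerivAt_gaussAngle z).add_const _).ofReal_comp.const_mul
        (n : ℂ)).mul_const I).const_add L')
    · exact (hv.hasDerivAt' z).sub
        (((hasDerivAt_gaussRate z).ofReal_comp.const_mul (n : ℂ)).mul_const I)
    · have := hv.continuous''
      have := continuous_gaussRate
      fun_prop
    · refine (norm_sub_le _ _).trans ?_
      rw [add_mul, mul_assoc ‖(n : ℂ)‖]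
      refine add_le_add (hv.norm_le' z) ?_
      rw [norm_mul, norm_mul, Complex.norm_I, mul_one, Complex.norm_real,
        Real.norm_of_nonneg (gaussRate_nonneg z)]
      gcongr
      exact hg1 z
    · refine (norm_sub_le _ _).trans ?_
      rw [add_mul, mul_assoc ‖(n : ℂ)‖]
      refine add_le_add (hv.norm_le'' z) ?_
      rw [norm_mul, norm_mul, Complex.norm_I, mul_one, Complex.norm_real, norm_mul,
        Real.norm_of_nonneg (gaussRate_nonneg z), norm_neg, Real.norm_eq_abs]
      exact mul_le_mul_of_nonneg_left (hg2 z) (norm_nonneg _)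
  have hutop : Tendsto u atTop (𝓝 0) := by
    have h1 : Tendsto (fun z => (L' + n * ((gaussAngle z + Real.pi : ℝ) : ℂ) * I)) atTop
        (𝓝 (L' + n * ((Real.pi + Real.pi : ℝ) : ℂ) * I)) :=
      ((((Complex.continuous_ofReal.tendsto _).comp (tendsto_gaussAngle_atTop.add_const _)).const_mul
        (n : ℂ)).mul_const I).const_add L'
    have h2 := ht.sub h1
    rw [hn] at h2
    convert! h2 using 2
    push_cast
    ring
  have hubot : Tendsto u atBot (𝓝 0) := by
    have h1 : Tendsto (fun z => (L' + n * ((gaussAngle z + Real.pi : ℝ) : ℂ) * I)) atBot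
        (𝓝 (L' + n * ((-Real.pi + Real.pi : ℝ) : ℂ) * I)) :=
      ((((Complex.continuous_ofReal.tendsto _).comp (tendsto_gaussAngle_atBot.add_const _)).const_mul
        (n : ℂ)).mul_const I).const_add L'
    have h2 := hb.sub h1
    convert! h2 using 2
    simp
  set E := B' + ‖(n : ℂ)‖ * G with hE
  have hE0 : 0 ≤ E := by positivity
  have hub := norm_le_of_deriv_decay hE0 huC.hasDerivAt huC.continuous' huC.norm_le' hutop hubot
  have hpi : E ≤ E * Real.pi := le_mul_of_one_le_right hE0 (by linarith [Real.pi_gt_three])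
  have hfb := FourierBound.of_decay (s := u) (B := E * Real.pi)
    ⟨huC.hasDerivAt, huC.hasDerivAt', huC.continuous'',
      fun z => (huC.norm_le' z).trans (mul_le_mul hpi (inv_one_add_sq_sq_le z) (hρ z) (by positivity)),
      fun z => (huC.norm_le'' z).trans
        (mul_le_mul hpi (inv_one_add_sq_sq_le z) (hρ z) (by positivity))⟩ hub
  refine ⟨n, _, _, ?_, hfb.add (FourierBound.const (L' + n * Real.pi * I)) (by positivity)
    (norm_nonneg _), fun z => ?_⟩
  · positivity
  · rw [hPv, hu]
    congr 1
    push_cast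
    ring

lemma exists_pos_le_norm_of_tendsto {g : ℝ → ℂ} (hg : Continuous g) (hne : ∀ z, g z ≠ 0)
    (ht : Tendsto g (cocompact ℝ) (𝓝 1)) : ∃ δ : ℝ, 0 < δ ∧ δ ≤ 1 ∧ ∀ z, δ ≤ ‖g z‖ := by
  have hev : ∀ᶠ z in cocompact ℝ, 1 / 2 < ‖g z‖ := by
    have := ht.norm
    rw [norm_one] at this
    exact this.eventually (lt_mem_nhds (by norm_num))
  obtain ⟨K, hK, hKs⟩ := mem_cocompact.1 hev
  rcases K.eq_empty_or_nonempty with rfl | hne'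
  · exact ⟨1 / 2, by norm_num, by norm_num, fun z => (hKs (by simp) : 1 / 2 < ‖g z‖).le⟩
  · obtain ⟨z₀, -, hz₀⟩ := hK.exists_isMinOn hne' hg.norm.continuousOn
    refine ⟨min ‖g z₀‖ (1 / 2), lt_min (norm_pos_iff.2 (hne z₀)) (by norm_num),
      (min_le_right _ _).trans (by norm_num), fun z => ?_⟩
    by_cases hz : z ∈ K
    · exact (min_le_left _ _).trans (hz₀ hz)
    · exact (min_le_right _ _).trans (hKs hz : 1 / 2 < ‖g z‖).le

lemma tendsto_inv_one_add_sq_cocompact :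
    Tendsto (fun z : ℝ => (1 + z ^ 2)⁻¹) (cocompact ℝ) (𝓝 0) := by
  refine tendsto_inv_atTop_zero.comp (tendsto_atTop_mono (fun z => ?_)
    (tendsto_norm_cocompact_atTop (E := ℝ)))
  rw [Real.norm_eq_abs]
  nlinarith [sq_abs z, sq_nonneg (|z| - 1), abs_nonneg z]

lemma norm_pow_sub_one_le {x : ℂ} {M : ℝ} (hM : 1 ≤ M) (hx : ‖x‖ ≤ M) (n : ℕ) :
    ‖x ^ n - 1‖ ≤ (n + 1) ^ 2 * M ^ n * ‖x - 1‖ := by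
  rw [← geom_sum_mul, norm_mul]
  gcongr
  calc ‖∑ i ∈ Finset.range n, x ^ i‖ ≤ ∑ i ∈ Finset.range n, M ^ n := by
        refine norm_sum_le_of_le _ fun i hi => ?_
        rw [norm_pow]
        exact (pow_le_pow_left₀ (norm_nonneg _) hx i).trans
          (pow_le_pow_right₀ hM (Finset.mem_range.1 hi).le)
    _ = n * M ^ n := by simp
    _ ≤ (n + 1) ^ 2 * M ^ n := by
        gcongr
        nlinarith [(Nat.cast_nonneg n : (0 : ℝ) ≤ n)]

/-- The Wiener–Lévy theorem on the line, for zero-free functions `1 + g` where `g` is the product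
of the Fourier transforms of an integrable function and of a complex measure. -/
theorem exists_log_one_add {f : ℝ → ℂ} (hf : Integrable f) {ψ : ℝ → ℂ} {C : ℝ} (hC : 0 ≤ C)
    (hψ : FourierBound ψ C) (hne : ∀ z, 1 + (∫ x, osc x z * f x) * ψ z ≠ 0) :
    ∃ n : ℤ, ∃ w C, 0 ≤ C ∧ FourierBound w C ∧
      ∀ z, 1 + (∫ x, osc x z * f x) * ψ z = Complex.exp (w z + n * gaussAngle z * I) := by
  have hcont : Continuous fun z => 1 + (∫ x, osc x z * f x) * ψ z :=
    continuous_const.add ((continuous_integral_osc (X := fun x => x) measurable_id hf).mul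
      hψ.continuous)
  have hlim : Tendsto (fun z => 1 + (∫ x, osc x z * f x) * ψ z) (cocompact ℝ) (𝓝 1) := by
    have := (tendsto_integral_osc_mul_cocompact f).zero_mul_isBoundedUnder_le (g := ψ)
      ⟨C, eventually_map.2 (.of_forall (hψ.norm_le hC))⟩
    simpa using this.const_add 1
  obtain ⟨δ, hδ, hδ1, hδg⟩ := exists_pos_le_norm_of_tendsto hcont hne hlim
  obtain ⟨s, s', s'', B, hB, hs, hsB, hE⟩ :=
    exists_c2_approx hf hC hψ (ε := δ / 3) (by positivity)
  set P : ℝ → ℂ := fun z => 1 + s z with hPdef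
  have hP : C2Bound P s' s'' B fun z => ((1 + z ^ 2)⁻¹) ^ 2 :=
    ⟨fun z => (hs.hasDerivAt z).const_add 1, hs.hasDerivAt', hs.continuous'', hs.norm_le',
      hs.norm_le''⟩
  have hE' : FourierBound (fun z => (1 + (∫ x, osc x z * f x) * ψ z) - P z) (δ / 3) :=
    hE.congr fun z => by rw [hPdef]; ring
  -- `|P| ≥ c`, and the approximation error `δ / 3` is half of `c`: the logarithmic series has ratio
  -- `1 / 2`.
  set c := 2 * δ / 3 with hc
  have hc0 : 0 < c := by positivity
  have hPc : ∀ z, c ≤ ‖P z‖ := fun z => by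
    have h1 := hE'.norm_le (by positivity) z
    have h2 := norm_sub_norm_le (1 + (∫ x, osc x z * f x) * ψ z) (P z)
    have h3 := hδg z
    linarith
  have hPne : ∀ z, P z ≠ 0 := fun z => norm_pos_iff.1 (hc0.trans_le (hPc z))
  have hinvc : ∀ z, ‖(P z)⁻¹‖ ≤ c⁻¹ := fun z => by
    rw [norm_inv]
    exact inv_anti₀ hc0 (hPc z)
  have hc1 : 1 ≤ c⁻¹ := (one_le_inv₀ hc0).2 (by linarith)
  have hρ : ∀ z : ℝ, (0 : ℝ) ≤ (1 + z ^ 2)⁻¹ := fun z => by positivity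
  have hP2 : C2Bound P s' s'' B fun z => (1 + z ^ 2)⁻¹ :=
    ⟨hP.hasDerivAt, hP.hasDerivAt', hP.continuous'',
      fun z => (hP.norm_le' z).trans (mul_le_mul_of_nonneg_left (inv_one_add_sq_sq_le z) hB),
      fun z => (hP.norm_le'' z).trans (mul_le_mul_of_nonneg_left (inv_one_add_sq_sq_le z) hB)⟩
  have hinv := hP2.inv hB hc0 hPc hρ inv_one_add_sq_le_one
  set D := B * c⁻¹ ^ 2 + 2 * B ^ 2 * c⁻¹ ^ 3 with hD
  have hD0 : 0 ≤ D := by positivity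
  set E := D + D ^ 2 + B * c⁻¹ with hEdef
  have hBc : 0 ≤ B * c⁻¹ := by positivity
  have hE0 : 0 ≤ E := by positivity
  have hpows : ∀ n : ℕ, FourierBound (fun z => (P z)⁻¹ ^ n)
      ((2 * Real.pi ^ 2 * E + 1) * ((n + 1) ^ 2 * c⁻¹ ^ n)) := fun n => by
    have hn : (1 : ℝ) ≤ (n + 1) ^ 2 * c⁻¹ ^ n :=
      one_le_mul_of_one_le_of_one_le (one_le_pow₀ (by simp)) (one_le_pow₀ hc1)
    have h1 := (hinv.pow hD0 hc1 hinvc hρ inv_one_add_sq_le_one n).mono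
      (B' := E * ((n + 1) ^ 2 * c⁻¹ ^ n))
      (mul_le_mul_of_nonneg_right (by linarith) (by positivity)) hρ
    have h2 := FourierBound.of_decay (s := fun z => (P z)⁻¹ ^ n - 1)
      ⟨fun z => (h1.hasDerivAt z).sub_const 1, h1.hasDerivAt', h1.continuous'', h1.norm_le',
        h1.norm_le''⟩ fun z => by
        refine (norm_pow_sub_one_le hc1 (hinvc z) n).trans ?_
        have e1 : ‖(P z)⁻¹ - 1‖ ≤ E * (1 + z ^ 2)⁻¹ := by
          have e2 : (P z)⁻¹ - 1 = -s z * (P z)⁻¹ := by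
            have := hPne z
            field_simp
            rw [hPdef]
            ring
          have hz := hρ z
          calc ‖(P z)⁻¹ - 1‖ = ‖s z‖ * ‖(P z)⁻¹‖ := by rw [e2, norm_mul, norm_neg]
            _ ≤ (B * (1 + z ^ 2)⁻¹) * c⁻¹ := by
                gcongr
                · exact (hsB z).trans (mul_le_mul_of_nonneg_left (inv_one_add_sq_sq_le z) hB)
                · exact hinvc z
            _ = B * c⁻¹ * (1 + z ^ 2)⁻¹ := by ring
            _ ≤ _ := by
                gcongr
                have : 0 ≤ D + D ^ 2 := by positivity
                linarith
        calc _ ≤ (n + 1) ^ 2 * c⁻¹ ^ n * (E * (1 + z ^ 2)⁻¹) := by gcongr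
          _ = _ := by ring
    refine ((h2.add (FourierBound.const 1) (by positivity) (norm_nonneg _)).mono ?_).congr
      fun z => by ring
    calc _ ≤ 2 * Real.pi ^ 2 * (E * ((n + 1) ^ 2 * c⁻¹ ^ n)) + (n + 1) ^ 2 * c⁻¹ ^ n := by
          rw [norm_one]
          gcongr
      _ = _ := by ring
  obtain ⟨w, C', hC', hw, hPw⟩ := FourierBound.exists_log_div (M := c⁻¹) hPne (by positivity)
    (by positivity) (by positivity) hinvc hE' hpows (by rw [hc]; field_simp; norm_num)
  have hPlim : Tendsto P (cocompact ℝ) (𝓝 1) := by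
    have h1 : Tendsto s (cocompact ℝ) (𝓝 0) := by
      refine squeeze_zero_norm (fun z => (hsB z).trans
        (mul_le_mul_of_nonneg_left (inv_one_add_sq_sq_le z) hB)) ?_
      simpa using tendsto_inv_one_add_sq_cocompact.const_mul B
    simpa using h1.const_add 1
  obtain ⟨n, u, C'', hC'', hu, hPu⟩ := exists_log_of_c2_decay hB hP hc0 hPc
    (hPlim.mono_left atTop_le_cocompact) (hPlim.mono_left atBot_le_cocompact)
  refine ⟨n, _, _, add_nonneg hC'' hC', hu.add hw hC'' hC', fun z => ?_⟩
  rw [hPw, hPu, ← Complex.exp_add]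
  congr 1
  ring

/-! ### The winding function as a Lévy exponent -/

lemma norm_osc_sub_one_le (x z : ℝ) : ‖osc x z - 1‖ ≤ |x * z| := by
  rw [osc, mul_comm _ I]
  simpa using Real.norm_exp_I_mul_ofReal_sub_one_le (x := x * z)

lemma integrable_gauss : Integrable fun x : ℝ => Real.exp (-(1 / 2) * x ^ 2) :=
  integrable_exp_neg_mul_sq (by norm_num)

lemma integral_osc_mul_gauss (z : ℝ) :
    ∫ x : ℝ, osc x z * (Real.exp (-(1 / 2) * x ^ 2) : ℂ) = gaussRate z := by
  have h := fourierIntegral_gaussian (b := 1 / 2) (by norm_num) z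
  have e1 : ∀ x : ℝ, Complex.exp (I * z * x) * Complex.exp (-(1 / 2) * x ^ 2) =
      osc x z * (Real.exp (-(1 / 2) * x ^ 2) : ℂ) := fun x => by
    rw [osc]
    push_cast
    ring_nf
  rw [integral_congr_ae (.of_forall e1)] at h
  rw [h, gaussRate]
  have e2 : ((Real.pi : ℂ) / (1 / 2)) ^ (1 / 2 : ℂ) = (√(2 * Real.pi) : ℂ) := by
    rw [Real.sqrt_eq_rpow, Complex.ofReal_cpow (by positivity)]
    push_cast
    congr 1
    ring
  rw [e2]
  push_cast
  congr 2
  ring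

/-- The exponent `i * gaussAngle` is of Lévy–Khintchine form, with the odd density
`e^{-x²/2}/x`. -/
lemma integral_osc_sub_one_mul_gauss (z : ℝ) :
    ∫ x : ℝ, (osc x z - 1) * ((Real.exp (-(1 / 2) * x ^ 2) / x : ℝ) : ℂ) = gaussAngle z * I := by
  have hmeas : ∀ z : ℝ, AEStronglyMeasurable
      (fun x : ℝ => (osc x z - 1) * ((Real.exp (-(1 / 2) * x ^ 2) / x : ℝ) : ℂ)) volume :=
    fun z => by
      have := continuous_osc_left z
      exact Measurable.aestronglyMeasurable (by fun_prop)
  have hd : ∀ z, HasDerivAt (fun z => ∫ x : ℝ,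
      (osc x z - 1) * ((Real.exp (-(1 / 2) * x ^ 2) / x : ℝ) : ℂ)) (gaussRate z * I) z := by
    intro z
    rw [← integral_osc_mul_gauss, ← integral_mul_const]
    refine (hasDerivAt_integral_of_dominated_loc_of_deriv_le
      (bound := fun x => Real.exp (-(1 / 2) * x ^ 2))
      (F' := fun z x => osc x z * (Real.exp (-(1 / 2) * x ^ 2) : ℂ) * I)
      univ_mem (.of_forall hmeas) ?_ ?_ ?_ integrable_gauss ?_).2
    · refine (integrable_gauss.const_mul |z|).mono' (hmeas z) (.of_forall fun x => ?_)
      rw [norm_mul, Complex.norm_real, Real.norm_eq_abs, abs_div, abs_of_pos (Real.exp_pos _)]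
      rcases eq_or_ne x 0 with rfl | hx
      · simp
      · calc _ ≤ |x * z| * (Real.exp (-(1 / 2) * x ^ 2) / |x|) := by
              gcongr
              exact norm_osc_sub_one_le x z
          _ = _ := by
              rw [abs_mul]
              have := abs_pos.2 hx
              field_simp
    · have := continuous_osc_left z
      exact Continuous.aestronglyMeasurable (by fun_prop)
    · refine .of_forall fun x z _ => ?_
      rw [norm_mul, norm_mul, norm_osc, Complex.norm_I, Complex.norm_real, Real.norm_eq_abs,
        abs_of_pos (Real.exp_pos _), one_mul, mul_one]
    · have h0 : ∀ᵐ x : ℝ ∂volume, x ≠ 0 := by simp [ae_iff]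
      filter_upwards [h0] with x hx z _
      convert! ((hasDerivAt_osc x z).sub_const 1).mul_const
        ((Real.exp (-(1 / 2) * x ^ 2) / x : ℝ) : ℂ) using 1
      have : (x : ℂ) ≠ 0 := by exact_mod_cast hx
      push_cast
      field_simp
  have hd2 : ∀ z, HasDerivAt (fun z => (gaussAngle z : ℂ) * I) (gaussRate z * I) z := fun z =>
    (hasDerivAt_gaussAngle z).ofReal_comp.mul_const I
  have hd3 := fun z => (hd z).sub (hd2 z)
  have := is_const_of_deriv_eq_zero (fun z => (hd3 z).differentiableAt)
    (fun z => (hd3 z).deriv.trans (sub_self _)) z 0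
  simpa [gaussAngle, sub_eq_zero] using this

/-! ### Exponents of Lévy–Khintchine type -/

/-- Continuous logarithms of the same function that agree at one point are equal. -/
lemma eq_of_exp_eq {f g : ℝ → ℂ} (hf : Continuous f) (hg : Continuous g)
    (h : ∀ z, Complex.exp (f z) = Complex.exp (g z)) (h0 : f 0 = g 0) (z : ℝ) : f z = g z := by
  have hcl : IsClopen {z | f z = g z} := by
    refine ⟨isClosed_eq hf hg, isOpen_iff_mem_nhds.2 fun z (hz : f z = g z) => ?_⟩
    have hc : Tendsto (fun y => ‖f y - g y‖) (𝓝 z) (𝓝 0) := by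
      have := (hf.sub hg).norm.tendsto z
      simpa [hz] using this
    filter_upwards [hc.eventually (gt_mem_nhds one_pos)] with y hy
    obtain ⟨n, hn⟩ := Complex.exp_eq_exp_iff_exists_int.1 (h y)
    have h1 : ‖f y - g y‖ = |(n : ℝ)| * (2 * Real.pi) := by
      rw [hn, add_sub_cancel_left]
      simp [abs_of_pos Real.pi_pos]
    have hn0 : n = 0 := by
      by_contra hne
      have h2 : (1 : ℝ) ≤ |(n : ℝ)| := by exact_mod_cast Int.one_le_abs hne
      rw [h1] at hy
      nlinarith [Real.pi_gt_three]
    change f y = g y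
    rw [hn, hn0]
    simp
  have := hcl.eq_univ ⟨0, h0⟩
  exact (this ▸ mem_univ z : z ∈ {z | f z = g z})

section Charges

variable {Ω : Type*} [MeasurableSpace Ω] {μ : Measure Ω} {X : Ω → ℝ} {k : Ω → ℂ}

lemma norm_osc_sub_one_le_min (x z : ℝ) : ‖osc x z - 1‖ ≤ (2 + |z|) * min 1 |x| := by
  rcases le_total |x| 1 with hx | hx
  · rw [min_eq_right hx]
    refine (norm_osc_sub_one_le x z).trans ?_
    rw [abs_mul]
    nlinarith [abs_nonneg x, abs_nonneg z]
  · rw [min_eq_left hx]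
    have : ‖osc x z - 1‖ ≤ 2 := (norm_sub_le _ _).trans (by simp; norm_num)
    linarith [abs_nonneg z]

lemma integrable_osc_sub_one_mul (hX : Measurable X) (hkm : AEStronglyMeasurable k μ)
    (hk : Integrable (fun ω => min 1 |X ω| * ‖k ω‖) μ) (z : ℝ) :
    Integrable (fun ω => (osc (X ω) z - 1) * k ω) μ := by
  refine (hk.const_mul (2 + |z|)).mono' ?_ (.of_forall fun ω => ?_)
  · exact ((((continuous_osc_left z).measurable.comp hX).sub_const 1).aestronglyMeasurable).mul hkm
  · rw [norm_mul, ← mul_assoc]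
    gcongr
    exact norm_osc_sub_one_le_min _ _

lemma continuous_integral_osc_sub_one_mul (hX : Measurable X) (hkm : AEStronglyMeasurable k μ)
    (hk : Integrable (fun ω => min 1 |X ω| * ‖k ω‖) μ) :
    Continuous fun z => ∫ ω, (osc (X ω) z - 1) * k ω ∂μ := by
  refine continuous_iff_continuousAt.2 fun z₀ => ?_
  refine continuousAt_of_dominated (bound := fun ω => (2 + (|z₀| + 1)) * (min 1 |X ω| * ‖k ω‖))
    (.of_forall fun z => (integrable_osc_sub_one_mul hX hkm hk z).aestronglyMeasurable) ?_
    (hk.const_mul _) (.of_forall fun ω => ?_)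
  · filter_upwards [(continuous_abs.tendsto z₀).eventually (gt_mem_nhds (lt_add_one _))] with z hz
    refine .of_forall fun ω => ?_
    rw [norm_mul, ← mul_assoc]
    have : (0 : ℝ) ≤ min 1 |X ω| := by positivity
    gcongr
    refine (norm_osc_sub_one_le_min _ _).trans ?_
    gcongr
  · exact (((continuous_osc_right _).sub continuous_const).mul continuous_const).continuousAt

end Charges

/-- A measure on `ℝ` without mass at `0` that integrates `1 ∧ |x|`: the Lévy measure of a process
of finite variation. -/
structure IsFiniteVariationLevy (m : Measure ℝ) : Prop where
  singleton_zero : m {0} = 0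
  lintegral_lt_top : ∫⁻ x, ENNReal.ofReal (min 1 |x|) ∂m < ∞

lemma isFiniteVariationLevy_map {M : Measure (ℝ × ℂ)} {g : ℂ → ℝ} (hg : Measurable g)
    (hgle : ∀ c, g c ≤ ‖c‖) (hM : Integrable (fun p : ℝ × ℂ => min 1 |p.1| * ‖p.2‖) M) :
    IsFiniteVariationLevy (((M.withDensity fun p => ENNReal.ofReal (g p.2)).map Prod.fst).restrict
      {0}ᶜ) := by
  refine ⟨?_, ?_⟩
  · rw [Measure.restrict_apply (measurableSet_singleton 0)]
    simp
  · refine (setLIntegral_le_lintegral _ _).trans_lt ?_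
    rw [lintegral_map (by fun_prop) measurable_fst,
      lintegral_withDensity_eq_lintegral_mul _ (by fun_prop) (by fun_prop)]
    refine lt_of_le_of_lt (lintegral_mono fun p => ?_) hM.hasFiniteIntegral
    rw [Pi.mul_apply, enorm_mul, mul_comm, Real.enorm_of_nonneg (by positivity), enorm_norm,
      ← ofReal_norm]
    gcongr
    exact hgle _

lemma integral_osc_sub_one_map {M : Measure (ℝ × ℂ)} {g : ℂ → ℝ} (hg : Measurable g) (z : ℝ) :
    ∫ x, (osc x z - 1) ∂(((M.withDensity fun p => ENNReal.ofReal (g p.2)).map Prod.fst).restrict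
      {0}ᶜ) = ∫ p, (osc p.1 z - 1) * ((max (g p.2) 0 : ℝ) : ℂ) ∂M := by
  have hm : Measurable fun x => osc x z - 1 := (continuous_osc_left z).measurable.sub_const 1
  rw [setIntegral_eq_integral_of_forall_compl_eq_zero (fun x hx => by
      rw [notMem_compl_iff, mem_singleton_iff] at hx
      simp [hx]),
    integral_map measurable_fst.aemeasurable hm.aestronglyMeasurable,
    integral_withDensity_eq_integral_toReal_smul (by fun_prop)
      (.of_forall fun p => ENNReal.ofReal_lt_top)]
  refine integral_congr_ae (.of_forall fun p => ?_)
  simp only [ENNReal.toReal_ofReal', Complex.real_smul]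
  ring

/-- If the characteristic function of `μ` has an exponent of finite variation given by a complex
charge, then it has such an exponent given by a signed charge: by the symmetry
`charFun μ (-z) = conj (charFun μ z)`, the charge can be replaced by its real part. -/
lemma exists_levy_pair_of_charge {μ : Measure ℝ} {M : Measure (ℝ × ℂ)} {γ : ℝ}
    (hM : Integrable (fun p : ℝ × ℂ => min 1 |p.1| * ‖p.2‖) M)
    (hμ : ∀ z, charFun μ z =
      Complex.exp (I * γ * z + ∫ p, (osc p.1 z - 1) * p.2 ∂M)) :
    ∃ m m' : Measure ℝ, IsFiniteVariationLevy m ∧ IsFiniteVariationLevy m' ∧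
      ∀ z, charFun μ z = Complex.exp (I * γ * z +
        ((∫ x, (osc x z - 1) ∂m) - ∫ x, (osc x z - 1) ∂m')) := by
  set Λ : ℝ → ℂ := fun z => I * γ * z + ∫ p, (osc p.1 z - 1) * p.2 ∂M with hΛ
  have hΛc : Continuous Λ := by
    have := continuous_integral_osc_sub_one_mul measurable_fst
      measurable_snd.aestronglyMeasurable hM
    fun_prop
  have hconj : ∀ x z : ℝ, (starRingEnd ℂ) (osc x (-z)) = osc x z := fun x z => by
    rw [osc, osc, ← Complex.exp_conj, map_mul, Complex.conj_I, Complex.conj_ofReal]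
    push_cast
    ring_nf
  have hΛ' : ∀ z, Λ z = (starRingEnd ℂ) (Λ (-z)) := by
    refine eq_of_exp_eq hΛc (Complex.continuous_conj.comp (hΛc.comp continuous_neg)) (fun z => ?_) ?_
    · rw [Complex.exp_conj, ← hμ, ← hμ, charFun_neg, Complex.conj_conj]
    · simp [hΛ]
  refine ⟨_, _, isFiniteVariationLevy_map (g := fun c => c.re) (by fun_prop)
    (fun c => (le_abs_self _).trans (Complex.abs_re_le_norm c)) hM,
    isFiniteVariationLevy_map (g := fun c => -c.re) (by fun_prop)
    (fun c => (neg_le_abs _).trans (Complex.abs_re_le_norm c)) hM, fun z => ?_⟩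
  have hcharge : ∀ g : ℂ → ℝ, Measurable g → (∀ c, |g c| ≤ ‖c‖) →
      Integrable (fun p : ℝ × ℂ => (osc p.1 z - 1) * (g p.2 : ℂ)) M := fun g hg hgle => by
    refine integrable_osc_sub_one_mul measurable_fst
      (by exact Measurable.aestronglyMeasurable (by fun_prop)) ?_ z
    refine hM.mono' (by exact Measurable.aestronglyMeasurable (by fun_prop))
      (.of_forall fun p => ?_)
    rw [norm_mul, norm_norm, Complex.norm_real, Real.norm_of_nonneg (by positivity)]
    gcongr
    exact hgle _
  rw [integral_osc_sub_one_map (g := fun c => c.re) (by fun_prop),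
    integral_osc_sub_one_map (g := fun c => -c.re) (by fun_prop), ← integral_sub]
  rotate_left
  · refine hcharge (fun c => max c.re 0) (by fun_prop) fun c => ?_
    rw [abs_of_nonneg (le_max_right _ _)]
    exact max_le ((le_abs_self _).trans (Complex.abs_re_le_norm c)) (norm_nonneg _)
  · refine hcharge (fun c => max (-c.re) 0) (by fun_prop) fun c => ?_
    rw [abs_of_nonneg (le_max_right _ _)]
    exact max_le ((neg_le_abs _).trans (Complex.abs_re_le_norm c)) (norm_nonneg _)
  have hint := integrable_osc_sub_one_mul measurable_fst measurable_snd.aestronglyMeasurable hM z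
  have hint' : Integrable (fun p : ℝ × ℂ => (osc p.1 z - 1) * (starRingEnd ℂ) p.2) M := by
    refine integrable_osc_sub_one_mul measurable_fst
      (Complex.continuous_conj.measurable.comp measurable_snd).aestronglyMeasurable ?_ z
    simpa using hM
  have e1 : (starRingEnd ℂ) (Λ (-z)) =
      I * γ * z + ∫ p, (osc p.1 z - 1) * (starRingEnd ℂ) p.2 ∂M := by
    rw [hΛ]
    simp only [map_add, map_mul, Complex.conj_I, Complex.conj_ofReal, ← integral_conj, map_sub,
      map_one, hconj]
    push_cast
    ring
  have e2 : Λ z = I * γ * z + ∫ p, ((osc p.1 z - 1) * ((max p.2.re 0 : ℝ) : ℂ)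
      - (osc p.1 z - 1) * ((max (-p.2.re) 0 : ℝ) : ℂ)) ∂M := by
    have e3 : Λ z = (Λ z + (starRingEnd ℂ) (Λ (-z))) / 2 := by
      rw [← hΛ']
      ring
    rw [e3, e1, hΛ]
    beta_reduce
    have e4 : ∀ p : ℝ × ℂ, (osc p.1 z - 1) * ((max p.2.re 0 : ℝ) : ℂ)
        - (osc p.1 z - 1) * ((max (-p.2.re) 0 : ℝ) : ℂ) =
        ((osc p.1 z - 1) * p.2 + (osc p.1 z - 1) * (starRingEnd ℂ) p.2) * (1 / 2) := fun p => by
      rw [← mul_add, Complex.add_conj, ← mul_sub, ← Complex.ofReal_sub]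
      have : max p.2.re 0 - max (-p.2.re) 0 = p.2.re := by
        rcases le_total 0 p.2.re with h | h
        · rw [max_eq_left h, max_eq_right (by linarith), sub_zero]
        · rw [max_eq_right h, max_eq_left (by linarith)]
          ring
      rw [this]
      push_cast
      ring
    rw [integral_congr_ae (.of_forall e4), integral_mul_const, integral_add hint hint']
    ring
  rw [hμ]
  exact congrArg Complex.exp e2

lemma charFun_withDensity (m : Measure ℝ) {f : ℝ → ℝ} (hf : Measurable f) (hf0 : ∀ x, 0 ≤ f x)
    (z : ℝ) : charFun (m.withDensity fun x => ENNReal.ofReal (f x)) z =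
      ∫ x, osc x z * (f x : ℂ) ∂m := by
  rw [charFun_apply_real, integral_withDensity_eq_integral_toReal_smul (by fun_prop)
    (.of_forall fun p => ENNReal.ofReal_lt_top)]
  refine integral_congr_ae (.of_forall fun x => ?_)
  simp only [ENNReal.toReal_ofReal (hf0 x), Complex.real_smul, osc]
  rw [mul_comm]
  congr 2
  push_cast
  ring

/-- A zero-free characteristic function of a probability measure with a lattice part and an
absolutely continuous part has an exponent of finite variation, provided that the Fourier transform
of the lattice part is zero-free. -/
theorem exists_levy_pair (μ μd : Measure ℝ) [IsProbabilityMeasure μ] {f : ℝ → ℝ} {r h : ℝ}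
    (hh : 0 < h) (hsupp : μd (lattice r h)ᶜ = 0) (hμd : ∀ z, charFun μd z ≠ 0)
    (hf : Measurable f) (hfi : Integrable f) (hf0 : ∀ x, 0 ≤ f x)
    (hμ : μ = μd + volume.withDensity fun x => ENNReal.ofReal (f x))
    (hne : ∀ z, charFun μ z ≠ 0) :
    ∃ (γ : ℝ) (m m' : Measure ℝ), IsFiniteVariationLevy m ∧ IsFiniteVariationLevy m' ∧
      ∀ z, charFun μ z = Complex.exp (I * γ * z +
        ((∫ x, (osc x z - 1) ∂m) - ∫ x, (osc x z - 1) ∂m')) := by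
  have hfin : IsFiniteMeasure μd := by
    refine isFiniteMeasure_of_le μ ?_
    rw [hμ]
    exact Measure.le_add_right le_rfl
  have hfin' : IsFiniteMeasure (volume.withDensity fun x => ENNReal.ofReal (f x)) := by
    refine isFiniteMeasure_of_le μ ?_
    rw [hμ]
    exact Measure.le_add_left le_rfl
  obtain ⟨b, w, C, hC, hw, hD⟩ := exists_log_charFun_lattice μd hh hsupp hμd
  have hsplit : ∀ z, charFun μ z = charFun μd z + ∫ x, osc x z * (f x : ℂ) := fun z => by
    rw [← charFun_withDensity volume hf hf0, hμ, charFun_apply, charFun_apply, charFun_apply,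
      integral_add_measure]
    all_goals
      refine Integrable.of_bound (C := 1) (by fun_prop) (.of_forall fun x => ?_)
      rw [Complex.norm_exp_ofReal_mul_I]
  set ψ : ℝ → ℂ := fun z => osc (-b) z * 1 * Complex.exp (-w z) with hψ
  have hψb : FourierBound ψ (‖(1 : ℂ)‖ * Real.exp C) :=
    (FourierBound.osc_mul (-b) 1).mul (hw.neg.exp hC) (norm_nonneg _)
  have hψD : ∀ z, charFun μd z * ψ z = 1 := fun z => by
    change _ * (osc (-b) z * 1 * Complex.exp (-w z)) = 1
    rw [hD, Complex.exp_neg]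
    have h1 : osc b z * osc (-b) z = 1 := by rw [← osc_add_left]; simp
    have h2 := Complex.exp_ne_zero (w z)
    field_simp
    exact h1
  have hfac : ∀ z, charFun μ z =
      charFun μd z * (1 + (∫ x, osc x z * (f x : ℂ)) * ψ z) := fun z => by
    rw [hsplit]
    linear_combination -(∫ x, osc x z * (f x : ℂ)) * hψD z
  obtain ⟨n, w', C', hC', hw', hF⟩ := exists_log_one_add (f := fun x => (f x : ℂ)) hfi.ofReal
    (by positivity) hψb fun z h0 => hne z (by rw [hfac, h0, mul_zero])
  obtain ⟨M, hM1, hM2, hM3⟩ := hw.add hw' hC hC'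
  beta_reduce at hM3
  have hMi := integrable_snd_of_lintegral hM2
  have hfac' : ∀ z, charFun μ z =
      osc b z * Complex.exp ((w z + w' z) + n * gaussAngle z * I) := fun z => by
    rw [hfac, hF, hD, mul_assoc, ← Complex.exp_add]
    ring_nf
  -- The constant in the exponent is removed by the normalisation at `z = 0`.
  have hnorm : Complex.exp (w 0 + w' 0) = 1 := by
    have := hfac' 0
    rw [charFun_zero] at this
    simpa [gaussAngle] using this.symm
  set N : Measure (ℝ × ℂ) := volume.map fun x : ℝ =>
    (x, (n : ℂ) * ((Real.exp (-(1 / 2) * x ^ 2) / x : ℝ) : ℂ)) with hN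
  have hNm : Measurable fun x : ℝ =>
    (x, (n : ℂ) * ((Real.exp (-(1 / 2) * x ^ 2) / x : ℝ) : ℂ)) := by fun_prop
  have i1 : Integrable (fun p : ℝ × ℂ => min 1 |p.1| * ‖p.2‖) M := by
    refine hMi.norm.mono' (by exact Measurable.aestronglyMeasurable (by fun_prop))
      (.of_forall fun p => ?_)
    rw [norm_mul, norm_norm, Real.norm_of_nonneg (by positivity)]
    exact mul_le_of_le_one_left (norm_nonneg _) (min_le_left _ _)
  have i2 : Integrable (fun p : ℝ × ℂ => min 1 |p.1| * ‖p.2‖) N := by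
    rw [hN, integrable_map_measure (by exact Measurable.aestronglyMeasurable (by fun_prop))
      hNm.aemeasurable]
    refine (integrable_gauss.const_mul |(n : ℝ)|).mono'
      (by exact Measurable.aestronglyMeasurable (by fun_prop)) (.of_forall fun x => ?_)
    simp only [Function.comp_apply]
    rw [norm_mul, norm_norm, Real.norm_of_nonneg (by positivity), norm_mul, Complex.norm_intCast,
      Complex.norm_real, Real.norm_eq_abs, abs_div, abs_of_pos (Real.exp_pos _)]
    rcases eq_or_ne x 0 with rfl | hx
    · simp
    · have hx' := abs_pos.2 hx
      calc _ ≤ |x| * (|(n : ℝ)| * (Real.exp (-(1 / 2) * x ^ 2) / |x|)) := by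
            gcongr
            exact min_le_right _ _
        _ = _ := by field_simp
  have hrep : ∀ z, charFun μ z =
      Complex.exp (I * b * z + ∫ p, (osc p.1 z - 1) * p.2 ∂(M + N)) := fun z => by
    rw [integral_add_measure
      (integrable_osc_sub_one_mul measurable_fst measurable_snd.aestronglyMeasurable i1 z)
      (integrable_osc_sub_one_mul measurable_fst measurable_snd.aestronglyMeasurable i2 z), hfac']
    have e1 : ∫ p, (osc p.1 z - 1) * p.2 ∂M = (w z + w' z) - (w 0 + w' 0) := by
      rw [hM3 z, hM3 0, ← integral_sub (integrable_osc_mul measurable_fst.aemeasurable hMi z)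
        (integrable_osc_mul measurable_fst.aemeasurable hMi 0)]
      refine integral_congr_ae (.of_forall fun p => ?_)
      simp only [osc_zero_right]
      ring
    have e2 : ∫ p, (osc p.1 z - 1) * p.2 ∂N = n * gaussAngle z * I := by
      have hcm := (continuous_osc_left z).measurable
      rw [hN, integral_map hNm.aemeasurable
        (by exact Measurable.aestronglyMeasurable (by fun_prop)), mul_assoc,
        ← integral_osc_sub_one_mul_gauss, ← integral_const_mul]
      refine integral_congr_ae (.of_forall fun x => ?_)
      ring
    have e3 : I * b * z + ((w z + w' z - (w 0 + w' 0)) + n * gaussAngle z * I) =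
        ((b * z : ℝ) : ℂ) * I + ((w z + w' z) + n * gaussAngle z * I) - (w 0 + w' 0) := by
      push_cast
      ring
    rw [e1, e2, e3, Complex.exp_sub, hnorm, div_one, osc, ← Complex.exp_add]
  obtain ⟨m, m', hm, hm', hmm⟩ := exists_levy_pair_of_charge (i1.add_measure i2) hrep
  exact ⟨b, m, m', hm, hm', hmm⟩

/-! ### Quasi-Lévy type measures and pairs of Lévy measures -/

/-- A Lévy measure: a measure on `ℝ` without mass at `0` that integrates `1 ∧ x²`. -/
structure IsLevyMeasure (m : Measure ℝ) : Prop where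
  singleton_zero : m {0} = 0
  lintegral_lt_top : ∫⁻ x, ENNReal.ofReal (min 1 (x ^ 2)) ∂m < ∞

lemma min_one_sq_le (x : ℝ) : min 1 (x ^ 2) ≤ min 1 |x| := by
  rcases le_total |x| 1 with hx | hx
  · rw [min_eq_right hx]
    refine (min_le_right _ _).trans ?_
    rw [← sq_abs]
    nlinarith [abs_nonneg x]
  · rw [min_eq_left hx]
    exact min_le_left _ _

lemma IsFiniteVariationLevy.isLevyMeasure {m : Measure ℝ} (h : IsFiniteVariationLevy m) :
    IsLevyMeasure m :=
  ⟨h.singleton_zero, (lintegral_mono fun x => ENNReal.ofReal_le_ofReal (min_one_sq_le x)).trans_lt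
    h.lintegral_lt_top⟩

namespace IsLevyMeasure

variable {m m' : Measure ℝ}

lemma add (h : IsLevyMeasure m) (h' : IsLevyMeasure m') : IsLevyMeasure (m + m') :=
  ⟨by simp [h.singleton_zero, h'.singleton_zero], by
    rw [lintegral_add_measure]
    exact ENNReal.add_lt_top.2 ⟨h.lintegral_lt_top, h'.lintegral_lt_top⟩⟩

lemma mono (h : IsLevyMeasure m) (hle : m' ≤ m) : IsLevyMeasure m' :=
  ⟨le_antisymm ((hle _).trans h.singleton_zero.le) zero_le,
    (lintegral_mono' hle le_rfl).trans_lt h.lintegral_lt_top⟩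

lemma integrable (h : IsLevyMeasure m) : Integrable (fun x => min 1 (x ^ 2)) m := by
  refine ⟨by exact Measurable.aestronglyMeasurable (by fun_prop), ?_⟩
  rw [hasFiniteIntegral_iff_ofReal (.of_forall fun x => by positivity)]
  exact h.lintegral_lt_top

lemma lt_top_of_borelAway (h : IsLevyMeasure m) {r : ℝ} (hr : 0 < r) {B : Set ℝ}
    (hB : B ∈ borelAway r) : m B < ∞ := by
  set c := ENNReal.ofReal (min 1 (r ^ 2)) with hc
  have hc0 : c ≠ 0 := by
    rw [hc, Ne, ENNReal.ofReal_eq_zero, not_le]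
    positivity
  have h1 : c * m B ≤ ∫⁻ x, ENNReal.ofReal (min 1 (x ^ 2)) ∂m := by
    rw [← setLIntegral_const]
    refine le_trans (setLIntegral_mono_ae (by fun_prop) (.of_forall fun x hx => ?_))
      (setLIntegral_le_lintegral _ _)
    have hrx : r ≤ |x| := by
      by_contra! hlt
      have : x ∈ B ∩ Ioo (-r) r := ⟨hx, abs_lt.1 hlt⟩
      rw [hB.2] at this
      exact this
    have : r ^ 2 ≤ x ^ 2 := by
      rw [← sq_abs x]
      gcongr
    exact ENNReal.ofReal_le_ofReal (min_le_min_left _ this)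
  by_contra! htop
  rw [top_le_iff] at htop
  rw [htop, ENNReal.mul_top hc0] at h1
  exact absurd (h1.trans_lt h.lintegral_lt_top) (lt_irrefl _)

end IsLevyMeasure

/-- Measures without mass at zero are compared on the Borel sets bounded away from zero. -/
lemma le_of_forall_borelAway {m m' : Measure ℝ} (h0 : m {0} = 0)
    (h : ∀ r > 0, ∀ B ∈ borelAway r, m B ≤ m' B) : m ≤ m' := by
  have hdisj : ∀ A : Set ℝ, Pairwise (Function.onFun Disjoint
      fun n => A ∩ LocalSignedMeasure.annulus n) := fun A i j hij =>
    (LocalSignedMeasure.pairwise_disjoint_annulus hij).mono inter_subset_right inter_subset_right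
  refine Measure.le_iff.2 fun A hA => ?_
  have hm : ∀ n, MeasurableSet (A ∩ LocalSignedMeasure.annulus n) := fun n =>
    hA.inter (LocalSignedMeasure.measurableSet_annulus n)
  calc m A ≤ m (⋃ n, A ∩ LocalSignedMeasure.annulus n) + m {0} := by
        refine (measure_mono ?_).trans (measure_union_le _ _)
        rw [← inter_iUnion, LocalSignedMeasure.iUnion_annulus]
        intro x hx
        by_cases hx0 : x = 0
        · exact Or.inr hx0
        · exact Or.inl ⟨hx, hx0⟩
    _ = ∑' n, m (A ∩ LocalSignedMeasure.annulus n) := by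
        rw [h0, add_zero, measure_iUnion (hdisj A) hm]
    _ ≤ ∑' n, m' (A ∩ LocalSignedMeasure.annulus n) := by
        exact ENNReal.tsum_le_tsum fun n =>
          h _ (by positivity) _ (LocalSignedMeasure.inter_annulus_mem hA n)
    _ = m' (⋃ n, A ∩ LocalSignedMeasure.annulus n) := (measure_iUnion (hdisj A) hm).symm
    _ ≤ m' A := measure_mono (iUnion_subset fun n => inter_subset_left)

lemma eq_of_forall_borelAway {m m' : Measure ℝ} (h0 : m {0} = 0) (h0' : m' {0} = 0)
    (h : ∀ r > 0, ∀ B ∈ borelAway r, m B = m' B) : m = m' :=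
  le_antisymm (le_of_forall_borelAway h0 fun r hr B hB => (h r hr B hB).le)
    (le_of_forall_borelAway h0' fun r hr B hB => (h r hr B hB).ge)

namespace LocalSignedMeasure

open scoped Classical in
/-- The difference of two Lévy measures, as a function on the Borel sets bounded away from zero. -/
def ofPair (m m' : Measure ℝ) (h : IsLevyMeasure m) (h' : IsLevyMeasure m') :
    LocalSignedMeasure where
  toFun B := if B ∈ borelAwayZero then m.real B - m'.real B else 0
  not_mem B hB := if_neg hB
  empty := by simp
  hasSum_iUnion r hr B hB hd := by
    have hU : (⋃ i, B i) ∈ borelAway r :=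
      ⟨.iUnion fun i => (hB i).1, by simp [iUnion_inter, (hB _).2]⟩
    have key : ∀ n : Measure ℝ, IsLevyMeasure n →
        HasSum (fun i => n.real (B i)) (n.real (⋃ i, B i)) := fun n hn => by
      have h1 := measure_iUnion (μ := n) hd fun i => (hB i).1
      rw [measureReal_def, h1,
        ENNReal.tsum_toReal_eq fun i => (hn.lt_top_of_borelAway hr (hB i)).ne]
      exact ENNReal.hasSum_toReal (h1 ▸ (hn.lt_top_of_borelAway hr hU).ne)
    have hmem : ∀ i, B i ∈ borelAwayZero := fun i => ⟨r, hr, hB i⟩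
    have hmemU : (⋃ i, B i) ∈ borelAwayZero := ⟨r, hr, hU⟩
    simp only [hmem, hmemU, if_true]
    exact (key m h).sub (key m' h')

lemma ofPair_apply {m m' : Measure ℝ} (h : IsLevyMeasure m) (h' : IsLevyMeasure m') {B : Set ℝ}
    (hB : B ∈ borelAwayZero) : (ofPair m m' h h').toFun B = m.real B - m'.real B :=
  if_pos hB

variable {ν : LocalSignedMeasure}

open scoped Classical in
lemma restr_apply {r : ℝ} (hr : 0 < r) {B : Set ℝ} (hB : B ∈ borelAway r) :
    ν.restr r hr B = ν.toFun B := by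
  have h1 : B \ Ioo (-r) r = B := (disjoint_iff_inter_eq_empty.2 hB.2).sdiff_eq_left
  change (if MeasurableSet B then ν.toFun (B \ Ioo (-r) r) else 0) = _
  rw [if_pos hB.1, h1]

lemma posPart_lt_top {r : ℝ} (hr : 0 < r) {B : Set ℝ} (hB : B ∈ borelAway r) :
    ν.posPart B < ∞ := by
  rw [posPart_apply ν hr hB]
  exact measure_lt_top _ _

lemma negPart_lt_top {r : ℝ} (hr : 0 < r) {B : Set ℝ} (hB : B ∈ borelAway r) :
    ν.negPart B < ∞ := by
  rw [negPart_apply ν hr hB]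
  exact measure_lt_top _ _

lemma toFun_eq_posPart_sub_negPart {r : ℝ} (hr : 0 < r) {B : Set ℝ} (hB : B ∈ borelAway r) :
    ν.toFun B = ν.posPart.real B - ν.negPart.real B := by
  rw [← restr_apply hr hB, SignedMeasure.apply_eq_posPart_real_sub_negPart_real _ hB.1,
    measureReal_def, measureReal_def, measureReal_def, measureReal_def, posPart_apply ν hr hB,
    negPart_apply ν hr hB]

/-- The Jordan decomposition is minimal among the representations of `ν` as a difference of
measures. -/
lemma posPart_le_and_negPart_le {m m' : Measure ℝ} (h : IsLevyMeasure m) (h' : IsLevyMeasure m')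
    (hν : ∀ r > 0, ∀ B ∈ borelAway r, ν.toFun B = m.real B - m'.real B) :
    ν.posPart ≤ m ∧ ν.negPart ≤ m' := by
  have key : ∀ r > 0, ∀ B ∈ borelAway r, ν.posPart B ≤ m B ∧ ν.negPart B ≤ m' B := by
    intro r hr B hB
    obtain ⟨S, hS, hS1, hS2⟩ := (ν.restr r hr).toJordanDecomposition.mutuallySingular
    have hBS : B ∩ S ∈ borelAway r := borelAway_inter hB hS
    have hBS' : B ∩ Sᶜ ∈ borelAway r := borelAway_inter hB hS.compl
    have p0 : ν.posPart (B ∩ S) = 0 := by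
      rw [posPart_apply ν hr hBS]
      exact measure_mono_null inter_subset_right hS1
    have n0 : ν.negPart (B ∩ Sᶜ) = 0 := by
      rw [negPart_apply ν hr hBS']
      exact measure_mono_null inter_subset_right hS2
    have hp : ν.posPart (B ∩ Sᶜ) ≤ m (B ∩ Sᶜ) := by
      have := toFun_eq_posPart_sub_negPart hr hBS' (ν := ν)
      rw [hν r hr _ hBS', measureReal_def ν.negPart, n0, ENNReal.toReal_zero, sub_zero] at this
      rw [← ENNReal.toReal_le_toReal (posPart_lt_top hr hBS').ne (h.lt_top_of_borelAway hr hBS').ne]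
      change ν.posPart.real _ ≤ m.real _
      rw [← this]
      linarith [measureReal_nonneg (μ := m') (s := B ∩ Sᶜ)]
    have hn : ν.negPart (B ∩ S) ≤ m' (B ∩ S) := by
      have := toFun_eq_posPart_sub_negPart hr hBS (ν := ν)
      rw [hν r hr _ hBS, measureReal_def ν.posPart, p0, ENNReal.toReal_zero, zero_sub] at this
      rw [← ENNReal.toReal_le_toReal (negPart_lt_top hr hBS).ne (h'.lt_top_of_borelAway hr hBS).ne]
      change ν.negPart.real _ ≤ m'.real _
      linarith [measureReal_nonneg (μ := m) (s := B ∩ S)]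
    constructor
    · calc ν.posPart B = ν.posPart (B ∩ S) + ν.posPart (B ∩ Sᶜ) := by
            rw [← sdiff_eq, measure_inter_add_sdiff _ hS]
        _ ≤ m B := by
            rw [p0, zero_add]
            exact hp.trans (measure_mono inter_subset_left)
    · calc ν.negPart B = ν.negPart (B ∩ S) + ν.negPart (B ∩ Sᶜ) := by
            rw [← sdiff_eq, measure_inter_add_sdiff _ hS]
        _ ≤ m' B := by
            rw [n0, add_zero]
            exact hn.trans (measure_mono inter_subset_left)
  exact ⟨le_of_forall_borelAway ν.posPart_singleton_zero fun r hr B hB => (key r hr B hB).1,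
    le_of_forall_borelAway ν.negPart_singleton_zero fun r hr B hB => (key r hr B hB).2⟩

lemma toFun_eq_sub_iff {m m' : Measure ℝ} (h : IsLevyMeasure m) (h' : IsLevyMeasure m') {r : ℝ}
    (hr : 0 < r) {B : Set ℝ} (hB : B ∈ borelAway r) :
    ν.toFun B = m.real B - m'.real B ↔ (ν.posPart + m') B = (m + ν.negPart) B := by
  have a1 := (h.lt_top_of_borelAway hr hB).ne
  have a2 := (h'.lt_top_of_borelAway hr hB).ne
  have a3 := (posPart_lt_top (ν := ν) hr hB).ne
  have a4 := (negPart_lt_top (ν := ν) hr hB).ne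
  rw [toFun_eq_posPart_sub_negPart hr hB, Measure.add_apply, Measure.add_apply,
    ← ENNReal.toReal_eq_toReal_iff' (ENNReal.add_ne_top.2 ⟨a3, a2⟩)
      (ENNReal.add_ne_top.2 ⟨a1, a4⟩), ENNReal.toReal_add a3 a2, ENNReal.toReal_add a1 a4]
  simp only [measureReal_def]
  constructor <;> intro h <;> linarith

lemma posPart_add_eq_of_toFun_eq {m m' : Measure ℝ} (h : IsLevyMeasure m) (h' : IsLevyMeasure m')
    (hν : ∀ r > 0, ∀ B ∈ borelAway r, ν.toFun B = m.real B - m'.real B) :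
    ν.posPart + m' = m + ν.negPart :=
  eq_of_forall_borelAway (by simp [h'.singleton_zero, ν.posPart_singleton_zero])
    (by simp [h.singleton_zero, ν.negPart_singleton_zero])
    fun r hr B hB => (toFun_eq_sub_iff h h' hr hB).1 (hν r hr B hB)

lemma IsQuasiLevyType.posPart (h : ν.IsQuasiLevyType) : IsLevyMeasure ν.posPart :=
  ⟨ν.posPart_singleton_zero, (lintegral_mono' (Measure.le_add_right le_rfl) le_rfl).trans_lt h⟩

lemma IsQuasiLevyType.negPart (h : ν.IsQuasiLevyType) : IsLevyMeasure ν.negPart :=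
  ⟨ν.negPart_singleton_zero, (lintegral_mono' (Measure.le_add_left le_rfl) le_rfl).trans_lt h⟩

end LocalSignedMeasure

/-! ### The Lévy–Khintchine integral -/

lemma levyKernel_eq (z x : ℝ) : levyKernel z x =
    osc x z - 1 - I * x * z * (Icc (-1 : ℝ) 1).indicator (fun _ => (1 : ℂ)) x := by
  rw [levyKernel, osc]
  congr 3
  push_cast
  ring

lemma levyKernel_zero_left (x : ℝ) : levyKernel 0 x = 0 := by simp [levyKernel]

lemma measurable_levyKernel (z : ℝ) : Measurable (levyKernel z) := by
  have h1 : Measurable ((Icc (-1 : ℝ) 1).indicator fun _ => (1 : ℂ)) :=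
    measurable_const.indicator measurableSet_Icc
  unfold levyKernel
  fun_prop

lemma norm_exp_mul_I_sub_one_sub_le (y : ℝ) :
    ‖Complex.exp (y * I) - 1 - y * I‖ ≤ 3 * y ^ 2 := by
  rcases le_total |y| 1 with hy | hy
  · have h := Complex.norm_exp_sub_one_sub_id_le (x := y * I) (by simpa using hy)
    rw [norm_mul, Complex.norm_I, mul_one, Complex.norm_real, Real.norm_eq_abs, sq_abs] at h
    nlinarith [sq_nonneg y]
  · have h1 : ‖Complex.exp (y * I) - 1 - y * I‖ ≤ 1 + 1 + |y| := by
      refine (norm_sub_le _ _).trans (add_le_add ((norm_sub_le _ _).trans ?_) ?_)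
      · rw [Complex.norm_exp_ofReal_mul_I, norm_one]
      · simp
    nlinarith [sq_abs y]

lemma norm_levyKernel_le (z x : ℝ) : ‖levyKernel z x‖ ≤ (2 + 3 * z ^ 2) * min 1 (x ^ 2) := by
  rw [levyKernel_eq]
  by_cases hx : x ∈ Icc (-1 : ℝ) 1
  · have hx2 : x ^ 2 ≤ 1 := by
      rw [← sq_abs]
      exact pow_le_one₀ (abs_nonneg x) (abs_le.2 hx)
    rw [min_eq_right hx2, indicator_of_mem hx, mul_one]
    have h := norm_exp_mul_I_sub_one_sub_le (x * z)
    have e : osc x z - 1 - I * x * z =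
        Complex.exp (((x * z : ℝ) : ℂ) * I) - 1 - ((x * z : ℝ) : ℂ) * I := by
      rw [osc]
      push_cast
      ring
    rw [e]
    nlinarith [sq_nonneg x]
  · have hx2 : 1 ≤ x ^ 2 := by
      by_contra! hlt
      exact hx (abs_le.1 (abs_le_one_iff_mul_self_le_one.2 (by nlinarith)))
    rw [min_eq_left hx2, indicator_of_notMem hx, mul_zero, sub_zero]
    have : ‖osc x z - 1‖ ≤ 2 := (norm_sub_le _ _).trans (by simp; norm_num)
    nlinarith [sq_nonneg z]

namespace IsLevyMeasure

variable {m : Measure ℝ}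

lemma integrable_levyKernel (h : IsLevyMeasure m) (z : ℝ) : Integrable (levyKernel z) m :=
  (h.integrable.const_mul (2 + 3 * z ^ 2)).mono' (measurable_levyKernel z).aestronglyMeasurable
    (.of_forall (norm_levyKernel_le z))

lemma continuous_integral_levyKernel (h : IsLevyMeasure m) :
    Continuous fun z => ∫ x, levyKernel z x ∂m := by
  refine continuous_iff_continuousAt.2 fun z₀ => continuousAt_of_dominated
    (bound := fun x => (2 + 3 * (|z₀| + 1) ^ 2) * min 1 (x ^ 2))
    (.of_forall fun z => (measurable_levyKernel z).aestronglyMeasurable) ?_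
    (h.integrable.const_mul _) (.of_forall fun x => ?_)
  · filter_upwards [(continuous_abs.tendsto z₀).eventually (gt_mem_nhds (lt_add_one _))] with z hz
    refine .of_forall fun x => (norm_levyKernel_le z x).trans ?_
    have : z ^ 2 ≤ (|z₀| + 1) ^ 2 := by
      rw [← sq_abs z]
      gcongr
    gcongr
  · unfold levyKernel
    exact Continuous.continuousAt (by fun_prop)

end IsLevyMeasure

/-- The weight produced by taking second differences of the Lévy–Khintchine integral with the step
sizes `1` and `√2`. As these are incommensurable, it vanishes only at `0`. -/
def diffWeight (x : ℝ) : ℝ := (2 - 2 * Real.cos x) + (2 - 2 * Real.cos (√2 * x))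

lemma continuous_diffWeight : Continuous diffWeight := by
  unfold diffWeight
  fun_prop

lemma diffWeight_nonneg (x : ℝ) : 0 ≤ diffWeight x := by
  have := Real.cos_le_one x
  have := Real.cos_le_one (√2 * x)
  unfold diffWeight
  linarith

lemma diffWeight_zero : diffWeight 0 = 0 := by simp [diffWeight]

lemma diffWeight_ne_zero {x : ℝ} (hx : x ≠ 0) : diffWeight x ≠ 0 := by
  intro h
  have h1 := Real.cos_le_one x
  have h2 := Real.cos_le_one (√2 * x)
  unfold diffWeight at h
  obtain ⟨k, hk⟩ := (Real.cos_eq_one_iff x).1 (by linarith)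
  obtain ⟨l, hl⟩ := (Real.cos_eq_one_iff (√2 * x)).1 (by linarith)
  have hk0 : (k : ℝ) ≠ 0 := by
    intro h0
    rw [h0, zero_mul] at hk
    exact hx hk.symm
  refine irrational_sqrt_two ⟨l / k, ?_⟩
  push_cast
  rw [div_eq_iff hk0]
  have hpi := Real.pi_pos
  rw [← hk] at hl
  have : (2 * Real.pi) * (l : ℝ) = (2 * Real.pi) * (√2 * k) := by linarith
  exact mul_left_cancel₀ (by positivity) this

lemma diffWeight_le (x : ℝ) : diffWeight x ≤ 8 * min 1 (x ^ 2) := by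
  have h1 := Real.one_sub_sq_div_two_le_cos (x := x)
  have h2 := Real.one_sub_sq_div_two_le_cos (x := √2 * x)
  rw [mul_pow, Real.sq_sqrt zero_le_two] at h2
  have h3 := Real.neg_one_le_cos x
  have h4 := Real.neg_one_le_cos (√2 * x)
  unfold diffWeight
  rcases le_total 1 (x ^ 2) with hx | hx
  · rw [min_eq_left hx]
    linarith
  · rw [min_eq_right hx]
    nlinarith [sq_nonneg x]

lemma levyKernel_second_difference (z t x : ℝ) :
    levyKernel (z + t) x + levyKernel (z - t) x - 2 * levyKernel z x =
      -(osc x z * ((2 - 2 * Real.cos (t * x) : ℝ) : ℂ)) := by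
  have h : osc x t + osc x (-t) = 2 * Complex.cos (t * x) := by
    rw [Complex.two_cos, osc, osc]
    push_cast
    ring_nf
  simp only [levyKernel_eq, sub_eq_add_neg z t, osc_add_right]
  push_cast
  linear_combination osc x z * h

/-- The weighted measure `diffWeight · m`, which is finite for a Lévy measure `m`. -/
def diffMeasure (m : Measure ℝ) : Measure ℝ :=
  m.withDensity fun x => ENNReal.ofReal (diffWeight x)

lemma diffMeasure_singleton_zero (m : Measure ℝ) : diffMeasure m {0} = 0 := by
  rw [diffMeasure, withDensity_apply _ (measurableSet_singleton 0)]
  simp [diffWeight_zero]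

namespace IsLevyMeasure

variable {m m' : Measure ℝ}

lemma integrable_diffWeight (h : IsLevyMeasure m) : Integrable diffWeight m := by
  refine (h.integrable.const_mul 8).mono' continuous_diffWeight.aestronglyMeasurable
    (.of_forall fun x => ?_)
  rw [Real.norm_of_nonneg (diffWeight_nonneg x)]
  exact diffWeight_le x

lemma isFiniteMeasure_diffMeasure (h : IsLevyMeasure m) : IsFiniteMeasure (diffMeasure m) :=
  isFiniteMeasure_withDensity_ofReal h.integrable_diffWeight.hasFiniteIntegral

lemma charFun_diffMeasure (h : IsLevyMeasure m) (z : ℝ) :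
    charFun (diffMeasure m) z = 4 * (∫ x, levyKernel z x ∂m) -
      ((∫ x, levyKernel (z + 1) x ∂m) + (∫ x, levyKernel (z - 1) x ∂m) +
        (∫ x, levyKernel (z + √2) x ∂m) + ∫ x, levyKernel (z - √2) x ∂m) := by
  have hi := h.integrable_levyKernel
  have hpt : ∀ x, osc x z * (diffWeight x : ℂ) = 4 * levyKernel z x -
      (levyKernel (z + 1) x + levyKernel (z - 1) x + levyKernel (z + √2) x
        + levyKernel (z - √2) x) := fun x => by
    have h1 := levyKernel_second_difference z 1 x
    have h2 := levyKernel_second_difference z √2 x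
    rw [diffWeight]
    rw [one_mul] at h1
    push_cast at h1 h2 ⊢
    linear_combination h1 + h2
  rw [diffMeasure, charFun_withDensity m continuous_diffWeight.measurable diffWeight_nonneg,
    integral_congr_ae (.of_forall hpt), integral_sub, integral_const_mul, integral_add,
    integral_add, integral_add]
  exacts [hi _, hi _, (hi _).add (hi _), hi _, ((hi _).add (hi _)).add (hi _), hi _,
    (hi _).const_mul _, (((hi _).add (hi _)).add (hi _)).add (hi _)]

/-- A Lévy measure is determined by its weighted version, as the weight is positive off `0`. -/
lemma eq_of_diffMeasure_eq (h : IsLevyMeasure m) (h' : IsLevyMeasure m')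
    (he : diffMeasure m = diffMeasure m') : m = m' := by
  have key : ∀ n : Measure ℝ, IsLevyMeasure n →
      (diffMeasure n).withDensity (fun x => (ENNReal.ofReal (diffWeight x))⁻¹) = n := fun n hn => by
    refine withDensity_inv_same (continuous_diffWeight.measurable.ennreal_ofReal) ?_
      (.of_forall fun x => ENNReal.ofReal_ne_top)
    have h0 : ∀ᵐ x ∂n, x ≠ 0 := by
      rw [ae_iff]
      simpa using hn.singleton_zero
    filter_upwards [h0] with x hx
    rw [Ne, ENNReal.ofReal_eq_zero, not_le]
    exact lt_of_le_of_ne (diffWeight_nonneg x) (diffWeight_ne_zero hx).symm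
  rw [← key m h, he, key m' h']

end IsLevyMeasure

lemma charFun_add_dirac {m : Measure ℝ} [IsFiniteMeasure m] (c z : ℝ) :
    charFun (m + ENNReal.ofReal c • Measure.dirac 0) z = charFun m z + (max c 0 : ℝ) := by
  have hf : IsFiniteMeasure (ENNReal.ofReal c • Measure.dirac (0 : ℝ)) :=
    Measure.smul_finite _ ENNReal.ofReal_ne_top
  rw [charFun_apply, charFun_apply, integral_add_measure]
  · rw [integral_smul_measure, integral_dirac]
    simp [ENNReal.toReal_ofReal']
  all_goals
    refine Integrable.of_bound (C := 1) (by fun_prop) (.of_forall fun x => ?_)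
    rw [Complex.norm_exp_ofReal_mul_I]

/-- Uniqueness in the Lévy–Khintchine formula, for differences of Lévy measures. -/
theorem levy_uniqueness {p q p' q' : Measure ℝ} (hp : IsLevyMeasure p) (hq : IsLevyMeasure q)
    (hp' : IsLevyMeasure p') (hq' : IsLevyMeasure q') {a γ γ' : ℝ}
    (h : ∀ z : ℝ, -(1 / 2 : ℂ) * a * z ^ 2 + I * γ * z +
        ((∫ x, levyKernel z x ∂p) - ∫ x, levyKernel z x ∂q) =
      I * γ' * z + ((∫ x, levyKernel z x ∂p') - ∫ x, levyKernel z x ∂q')) :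
    a = 0 ∧ p + q' = p' + q := by
  have l1 := hp.add hq'
  have l2 := hp'.add hq
  have f1 := l1.isFiniteMeasure_diffMeasure
  have f2 := l2.isFiniteMeasure_diffMeasure
  have hfin : ∀ c : ℝ, IsFiniteMeasure (ENNReal.ofReal c • Measure.dirac (0 : ℝ)) := fun c =>
    Measure.smul_finite _ ENNReal.ofReal_ne_top
  have hadd : ∀ {m n : Measure ℝ}, IsLevyMeasure m → IsLevyMeasure n → ∀ z,
      ∫ x, levyKernel z x ∂(m + n) = (∫ x, levyKernel z x ∂m) + ∫ x, levyKernel z x ∂n :=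
    fun hm hn z => integral_add_measure (hm.integrable_levyKernel z) (hn.integrable_levyKernel z)
  have f3 := hfin (3 * a)
  have f4 := hfin (-(3 * a))
  -- The Gaussian part contributes a point mass at `0` to the second differences.
  have hmeas : diffMeasure (p + q') + ENNReal.ofReal (3 * a) • Measure.dirac 0 =
      diffMeasure (p' + q) + ENNReal.ofReal (-(3 * a)) • Measure.dirac 0 := by
    refine Measure.ext_of_charFun (funext fun z => ?_)
    rw [charFun_add_dirac, charFun_add_dirac, l1.charFun_diffMeasure, l2.charFun_diffMeasure]
    simp only [hadd hp hq', hadd hp' hq]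
    have hmax : ((max (3 * a) 0 : ℝ) : ℂ) - ((max (-(3 * a)) 0 : ℝ) : ℂ) = 3 * a := by
      rw [← Complex.ofReal_sub]
      have : max (3 * a) 0 - max (-(3 * a)) 0 = 3 * a := by
        rcases le_total 0 (3 * a) with h0 | h0
        · rw [max_eq_left h0, max_eq_right (by linarith), sub_zero]
        · rw [max_eq_right h0, max_eq_left (by linarith)]
          ring
      rw [this]
      push_cast
      ring
    have h0 := h z
    have h1 := h (z + 1)
    have h2 := h (z - 1)
    have h3 := h (z + √2)
    have h4 := h (z - √2)
    have hs : ((√2 : ℝ) : ℂ) ^ 2 = 2 := by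
      rw [← Complex.ofReal_pow, Real.sq_sqrt zero_le_two]
      norm_num
    push_cast at h1 h2 h3 h4
    linear_combination 4 * h0 - h1 - h2 - h3 - h4 + hmax - a * hs
  have ha : a = 0 := by
    have h0 := congrArg (fun m : Measure ℝ => m {0}) hmeas
    simp only [Measure.add_apply, Measure.smul_apply, diffMeasure_singleton_zero, zero_add,
      Measure.dirac_apply' _ (measurableSet_singleton (0 : ℝ)), indicator_of_mem (mem_singleton _),
      Pi.one_apply, smul_eq_mul, mul_one] at h0
    have h1 := congrArg ENNReal.toReal h0
    rw [ENNReal.toReal_ofReal', ENNReal.toReal_ofReal'] at h1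
    rcases le_total 0 (3 * a) with h2 | h2
    · rw [max_eq_left h2, max_eq_right (by linarith)] at h1
      linarith
    · rw [max_eq_right h2, max_eq_left (by linarith)] at h1
      linarith
  refine ⟨ha, l1.eq_of_diffMeasure_eq l2 ?_⟩
  simpa [ha] using hmeas

/-! ### Characteristic triplets -/

namespace IsFiniteVariationLevy

variable {m : Measure ℝ}

lemma integrable (h : IsFiniteVariationLevy m) : Integrable (fun x => min 1 |x|) m := by
  refine ⟨by exact Measurable.aestronglyMeasurable (by fun_prop), ?_⟩
  rw [hasFiniteIntegral_iff_ofReal (.of_forall fun x => by positivity)]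
  exact h.lintegral_lt_top

lemma setLIntegral_abs_lt_top (h : IsFiniteVariationLevy m) :
    ∫⁻ x in Icc (-1 : ℝ) 1, ENNReal.ofReal |x| ∂m < ∞ := by
  refine lt_of_le_of_lt ?_ h.lintegral_lt_top
  refine le_trans (setLIntegral_mono_ae (by fun_prop) (.of_forall fun x hx => ?_))
    (setLIntegral_le_lintegral _ _)
  rw [min_eq_right (abs_le.2 hx)]

/-- The truncated first moment, by which the drift changes between the two common forms of the
Lévy–Khintchine integrand. -/
lemma integral_osc_sub_one (h : IsFiniteVariationLevy m) (z : ℝ) :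
    ∫ x, (osc x z - 1) ∂m =
      (∫ x, levyKernel z x ∂m) + I * z * ((∫ x in Icc (-1 : ℝ) 1, x ∂m : ℝ) : ℂ) := by
  have hx : Integrable ((Icc (-1 : ℝ) 1).indicator fun x => x) m := by
    refine h.integrable.mono' (measurable_id.indicator measurableSet_Icc).aestronglyMeasurable
      (.of_forall fun x => ?_)
    by_cases hx : x ∈ Icc (-1 : ℝ) 1
    · rw [indicator_of_mem hx, Real.norm_eq_abs, min_eq_right (abs_le.2 hx)]
    · rw [indicator_of_notMem hx, norm_zero]
      positivity
  have hx' : Integrable (fun x => I * z * (((Icc (-1 : ℝ) 1).indicator (fun x => x) x : ℝ) : ℂ)) m :=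
    hx.ofReal.const_mul _
  rw [← integral_indicator measurableSet_Icc, ← integral_complex_ofReal, ← integral_const_mul,
    ← integral_add (h.isLevyMeasure.integrable_levyKernel z) hx']
  refine integral_congr_ae (.of_forall fun x => ?_)
  simp only [levyKernel_eq]
  by_cases hx : x ∈ Icc (-1 : ℝ) 1
  · simp only [indicator_of_mem hx]
    ring
  · simp [indicator_of_notMem hx]

end IsFiniteVariationLevy

lemma HasCharacteristicTriplet.charFun_ne_zero {μ : Measure ℝ} {a γ : ℝ} {ν : LocalSignedMeasure}
    (h : HasCharacteristicTriplet μ a γ ν) (z : ℝ) : charFun μ z ≠ 0 := by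
  rw [h.2]
  exact Complex.exp_ne_zero _

lemma isQuasiInfinitelyDivisible_of_levy_pair {μ : Measure ℝ} {γ : ℝ} {m m' : Measure ℝ}
    (hm : IsLevyMeasure m) (hm' : IsLevyMeasure m')
    (h : ∀ z, charFun μ z = Complex.exp (I * γ * z +
      ((∫ x, levyKernel z x ∂m) - ∫ x, levyKernel z x ∂m'))) :
    IsQuasiInfinitelyDivisible μ := by
  set ν := LocalSignedMeasure.ofPair m m' hm hm' with hν
  have hpair : ∀ r > 0, ∀ B ∈ borelAway r, ν.toFun B = m.real B - m'.real B :=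
    fun r hr B hB => LocalSignedMeasure.ofPair_apply hm hm' ⟨r, hr, hB⟩
  obtain ⟨hle, hle'⟩ := LocalSignedMeasure.posPart_le_and_negPart_le hm hm' hpair
  have heq := LocalSignedMeasure.posPart_add_eq_of_toFun_eq hm hm' hpair
  have lp := hm.mono hle
  have ln := hm'.mono hle'
  refine ⟨0, γ, ν, (lp.add ln).lintegral_lt_top, fun z => ?_⟩
  have hk := congrArg (fun n : Measure ℝ => ∫ x, levyKernel z x ∂n) heq
  beta_reduce at hk
  rw [integral_add_measure (lp.integrable_levyKernel z) (hm'.integrable_levyKernel z),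
    integral_add_measure (hm.integrable_levyKernel z) (ln.integrable_levyKernel z)] at hk
  rw [h, LocalSignedMeasure.integral]
  congr 1
  push_cast
  linear_combination -hk

/-- If the characteristic function has an exponent given by Lévy measures of finite variation, then
every characteristic triplet has Gaussian variance zero and a quasi-Lévy measure of finite
variation. -/
lemma HasCharacteristicTriplet.of_levy_pair {μ : Measure ℝ} [IsProbabilityMeasure μ] {γ₀ : ℝ}
    {m m' : Measure ℝ} (hm : IsFiniteVariationLevy m) (hm' : IsFiniteVariationLevy m')
    (h : ∀ z, charFun μ z = Complex.exp (I * γ₀ * z +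
      ((∫ x, levyKernel z x ∂m) - ∫ x, levyKernel z x ∂m')))
    {a γ : ℝ} {ν : LocalSignedMeasure} (hν : HasCharacteristicTriplet μ a γ ν) :
    a = 0 ∧ ∫⁻ x in Icc (-1 : ℝ) 1, ENNReal.ofReal |x| ∂ν.totalVariation < ∞ := by
  have lm := hm.isLevyMeasure
  have lm' := hm'.isLevyMeasure
  have lp := hν.1.posPart
  have ln := hν.1.negPart
  have c1 := lm.continuous_integral_levyKernel
  have c2 := lm'.continuous_integral_levyKernel
  have c3 := lp.continuous_integral_levyKernel
  have c4 := ln.continuous_integral_levyKernel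
  have hexp : ∀ z : ℝ, -(1 / 2 : ℂ) * a * z ^ 2 + I * γ * z +
        ((∫ x, levyKernel z x ∂ν.posPart) - ∫ x, levyKernel z x ∂ν.negPart) =
      I * γ₀ * z + ((∫ x, levyKernel z x ∂m) - ∫ x, levyKernel z x ∂m') := by
    refine eq_of_exp_eq (by fun_prop) (by fun_prop) (fun z => ?_) ?_
    · rw [← h, hν.2, LocalSignedMeasure.integral]
    · simp [levyKernel_zero_left]
  obtain ⟨ha, heq⟩ := levy_uniqueness lp ln lm lm' hexp
  have hpair : ∀ r > 0, ∀ B ∈ borelAway r, ν.toFun B = m.real B - m'.real B := fun r hr B hB =>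
    (LocalSignedMeasure.toFun_eq_sub_iff lm lm' hr hB).2 (by rw [heq])
  obtain ⟨hle, hle'⟩ := LocalSignedMeasure.posPart_le_and_negPart_le lm lm' hpair
  refine ⟨ha, ?_⟩
  rw [LocalSignedMeasure.totalVariation, Measure.restrict_add, lintegral_add_measure]
  exact ENNReal.add_lt_top.2
    ⟨(lintegral_mono' (Measure.restrict_mono le_rfl hle) le_rfl).trans_lt
        hm.setLIntegral_abs_lt_top,
      (lintegral_mono' (Measure.restrict_mono le_rfl hle') le_rfl).trans_lt
        hm'.setLIntegral_abs_lt_top⟩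

end QuasiInfDiv

end

theorem mainTheorem5 (μ μd : Measure ℝ) [IsProbabilityMeasure μ] (f : ℝ → ℝ) (r h : ℝ)
    (hh : 0 < h)
    (hμd_ne : μd ≠ 0)
    (hμd_supp : μd (QuasiInfDiv.lattice r h)ᶜ = 0)
    (hμd_char : ∀ z : ℝ, charFun μd z ≠ 0)
    (hf_meas : Measurable f) (hf_int : Integrable f volume) (hf_nonneg : ∀ x, 0 ≤ f x)
    (hμ : μ = μd + volume.withDensity (fun x => ENNReal.ofReal (f x))) :
    (QuasiInfDiv.IsQuasiInfinitelyDivisible μ ↔ ∀ z : ℝ, charFun μ z ≠ 0) ∧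
    (QuasiInfDiv.IsQuasiInfinitelyDivisible μ →
      ∀ (a γ : ℝ) (ν : QuasiInfDiv.LocalSignedMeasure),
        QuasiInfDiv.HasCharacteristicTriplet μ a γ ν →
          a = 0 ∧
          ∫⁻ x in Set.Icc (-1 : ℝ) 1, ENNReal.ofReal |x| ∂ν.totalVariation < ⊤) := by
  have key : (∀ z : ℝ, charFun μ z ≠ 0) → ∃ (γ : ℝ) (m m' : Measure ℝ),
      QuasiInfDiv.IsFiniteVariationLevy m ∧ QuasiInfDiv.IsFiniteVariationLevy m' ∧
        ∀ z, charFun μ z = Complex.exp (Complex.I * γ * z +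
          ((∫ x, QuasiInfDiv.levyKernel z x ∂m) - ∫ x, QuasiInfDiv.levyKernel z x ∂m')) := by
    intro hne
    obtain ⟨γ, m, m', hm, hm', hμm⟩ := QuasiInfDiv.exists_levy_pair μ μd hh hμd_supp hμd_char
      hf_meas hf_int hf_nonneg hμ hne
    refine ⟨γ + ((∫ x in Icc (-1 : ℝ) 1, x ∂m) - ∫ x in Icc (-1 : ℝ) 1, x ∂m'), m, m', hm, hm',
      fun z => ?_⟩
    rw [hμm, hm.integral_osc_sub_one, hm'.integral_osc_sub_one]
    congr 1
    push_cast
    ring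
  refine ⟨⟨?_, fun hne => ?_⟩, ?_⟩
  · rintro ⟨a, γ, ν, hν⟩
    exact hν.charFun_ne_zero
  · obtain ⟨γ, m, m', hm, hm', hμm⟩ := key hne
    exact QuasiInfDiv.isQuasiInfinitelyDivisible_of_levy_pair hm.isLevyMeasure hm'.isLevyMeasure hμm
  · intro _ a γ ν hν
    obtain ⟨γ₀, m, m', hm, hm', hμm⟩ := key hν.charFun_ne_zero
    exact hν.of_levy_pair hm hm' hμm
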